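/- **Setting.** An electrical network $G$ is a connected simple graph on a finite or countable vertex set $V_G$ with symmetric conductances $c_G(x,y)\ge 0$, positive exactly on the edges, such that $c_G(x)=\sum_y c_G(x,y)<\infty$ for all $x$. Let $\mu_G(A)=\sum_{x\in A}c_G(x)$, let $\mathcal E_G(f,g)=\frac12\sum_{x,y}c_G(x,y)(f(x)-f(y))(g(x)-g(y))$ with domain $\mathcal F_G=\{f:\mathcal E_G(f,f)<\infty\}$, and let $R_G(x,y)=\sup\{|f(x)-f(y)|^2/\mathcal E_G(f,f): f\in\mathcal F_G,\ \mathcal E_G(f,f)>0\}$ be the resistance metric. For a non-empty $B\subseteq V_G$ and a function $\varphi$ on $B$ that has an extension in $\mathcal F_G$, let $h_B(\varphi)$ be the minimizer of $\mathcal E_G(u,u)$ over $u\in\mathcal F_G$ with $u|_B=\varphi$. The trace $G|_B$ is the electrical network with vertex set $B$ and conductances $c_{G|_B}(x,y)=-\mathcal E_G\big(h_B(1_{\{x\}}),h_B(1_{\{y\}})\big)$ for $x\ne y$ and $c_{G|_B}(x,x)=0$. All networks $G$ below have a root $\rho_G$, and we assume that $(V_G,R_G)$ is boundedly compact (closed balls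 are compact) and that $G$ is recurrent: the effective resistance between $\rho_G$ and $\{x:R_G(\rho_G,x)\ge r\}$ tends to $\infty$ as $r\to\infty$. Convergence of rooted compact metric spaces with a finite Borel measure is in the pointed Gromov–Hausdorff–Prohorov (GHP) topology. **(1) Deterministic version.** Let $(G_n)$ be a sequence of such networks with roots $\rho_n$, let $a_n,b_n>0$, and let $K_n$ be a compact subset of $(V_{G_n},a_n^{-1}R_{G_n})$ with $\rho_n\in K_n$. Let $(F,R,\rho,\mu)$ be a rooted boundedly compact metric space with a Radon measure, and $K\subseteq F$ a compact subset with $\rho\in K$. Suppose that $$\Big(K_n,\ a_n^{-1}R_{G_n}|_{K_n\times K_n},\ \rho_n,\ b_n^{-1}\mu_{G_n}(\cdot\cap K_n)\Big)\to\big(K,\ R|_{K\times K},\ \rho,\ \mu(\cdot\cap K)\big)$$ in the GHP topology, and that the total scaled conductance $\mathsf{CC}_n(K_n)=\sum_{x\in K_n,\,y\notin K_n}b_n^{-1}c_{G_n}(x,y)$ on edges crossing the boundary of $K_n$ tends to $0$. Then $$\Big(K_n,\ a_n^{-1}R_{G_n|_{K_n}},\ \rho_n,\ b_n^{-1}\mu_{G_n|_{K_n}}\Big)\to\big(K,\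 R|_{K\times K},\ \rho,\ \mu(\cdot\cap K)\big)$$ in the GHP topology. **(2) Random version.** Let $a_n,b_n>0$ be deterministic, and suppose that $G_n$ and $K_n$ as in (1) are random, on a probability space that may depend on $n$, and that $F$ and $K$ as in (1) are random, such that $(K_n,a_n^{-1}R_{G_n}|_{K_n\times K_n},\rho_n,b_n^{-1}\mu_{G_n}(\cdot\cap K_n))$ and $(K,R|_{K\times K},\rho,\mu(\cdot\cap K))$ are random elements of the space of rooted compact metric spaces with a finite measure, equipped with the GHP topology and its Borel $\sigma$-algebra. If the former converges in distribution to the latter, and $\mathsf{CC}_n(K_n)\to0$ in probability, then $(K_n,a_n^{-1}R_{G_n|_{K_n}},\rho_n,b_n^{-1}\mu_{G_n|_{K_n}})$ are random elements too, and they converge in distribution to $(K,R|_{K\times K},\rho,\mu(\cdot\cap K))$. -/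

import Mathlib

open Filter Topology MeasureTheory Set
open scoped ENNReal

/-- An electrical network: a connected simple graph on a (finite or countable) vertex set with
symmetric conductances that are positive exactly on the edges, and finite at every vertex. -/
structure ElectricalNetwork where
  V : Type
  countable : Countable V
  graph : SimpleGraph V
  connected : graph.Connected
  c : V → V → ℝ
  c_nonneg : ∀ x y, 0 ≤ c x y
  c_symm : ∀ x y, c x y = c y x
  c_pos_iff : ∀ x y, 0 < c x y ↔ graph.Adj x y
  summable_c : ∀ x, Summable (c x)

namespace ElectricalNetwork

variable (G : ElectricalNetwork)

/-- The total conductance `c(x) = ∑ y, c(x, y)` at a vertex. -/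
noncomputable def cTot (x : G.V) : ℝ := ∑' y, G.c x y

/-- The energy form `ℰ(f, g) = 1/2 ∑_{x, y} c(x, y) (f x - f y) (g x - g y)`. -/
noncomputable def energy (f g : G.V → ℝ) : ℝ :=
  (1 / 2) * ∑' p : G.V × G.V, G.c p.1 p.2 * (f p.1 - f p.2) * (g p.1 - g p.2)

/-- The domain `ℱ` of the form: functions of finite energy. -/
def FiniteEnergy (f : G.V → ℝ) : Prop :=
  Summable fun p : G.V × G.V => G.c p.1 p.2 * (f p.1 - f p.2) ^ 2

/-- The (effective) resistance metric. -/
noncomputable def resistance (x y : G.V) : ℝ :=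
  sSup {r : ℝ | ∃ f, G.FiniteEnergy f ∧ 0 < G.energy f f ∧ r = |f x - f y| ^ 2 / G.energy f f}

/-- The effective resistance between two sets, with values in `[0, ∞]`. -/
noncomputable def resistanceSets (A B : Set G.V) : ℝ≥0∞ :=
  (⨅ (f : G.V → ℝ) (_ : G.FiniteEnergy f) (_ : ∀ x ∈ A, f x = 1) (_ : ∀ x ∈ B, f x = 0),
    ENNReal.ofReal (G.energy f f))⁻¹

/-! ### Basic properties of the energy -/

variable {G}

theorem c_self (x : G.V) : G.c x x = 0 := by
  have h := (G.c_pos_iff x x).not.2 (G.graph.loopless.irrefl x)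
  exact le_antisymm (not_lt.1 h) (G.c_nonneg x x)

theorem energy_symm (f g : G.V → ℝ) : G.energy f g = G.energy g f := by
  unfold energy
  congr 1
  exact tsum_congr fun p => by ring

theorem FiniteEnergy.of_contraction {f g : G.V → ℝ} (hf : G.FiniteEnergy f)
    (h : ∀ x y, |g x - g y| ≤ |f x - f y|) : G.FiniteEnergy g :=
  Summable.of_nonneg_of_le (fun _ => mul_nonneg (G.c_nonneg _ _) (sq_nonneg _))
    (fun _ => mul_le_mul_of_nonneg_left (sq_le_sq.2 (h _ _)) (G.c_nonneg _ _)) hf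

theorem finiteEnergy_const (r : ℝ) : G.FiniteEnergy fun _ => r := by
  simp [FiniteEnergy, summable_zero]

theorem FiniteEnergy.smul {f : G.V → ℝ} (hf : G.FiniteEnergy f) (r : ℝ) :
    G.FiniteEnergy (r • f) := by
  refine (Summable.mul_left (r ^ 2) hf).congr fun p => ?_
  simp only [Pi.smul_apply, smul_eq_mul]; ring

theorem FiniteEnergy.add {f g : G.V → ℝ} (hf : G.FiniteEnergy f) (hg : G.FiniteEnergy g) :
    G.FiniteEnergy (f + g) := by
  refine Summable.of_nonneg_of_le (fun _ => mul_nonneg (G.c_nonneg _ _) (sq_nonneg _))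
    (fun p => ?_) ((Summable.mul_left 2 hf).add (Summable.mul_left 2 hg))
  have := G.c_nonneg p.1 p.2
  simp only [Pi.add_apply]
  nlinarith [mul_nonneg this (sq_nonneg ((f p.1 - f p.2) - (g p.1 - g p.2)))]

theorem FiniteEnergy.sub {f g : G.V → ℝ} (hf : G.FiniteEnergy f) (hg : G.FiniteEnergy g) :
    G.FiniteEnergy (f - g) := by
  have := hf.add (hg.smul (-1))
  rwa [neg_one_smul, ← sub_eq_add_neg] at this

theorem summable_energy {f g : G.V → ℝ} (hf : G.FiniteEnergy f) (hg : G.FiniteEnergy g) :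
    Summable fun p : G.V × G.V => G.c p.1 p.2 * (f p.1 - f p.2) * (g p.1 - g p.2) := by
  have hs := hf.add hg
  have hd := hf.sub hg
  refine ((Summable.sub hs hd).mul_left (1 / 4)).congr fun p => ?_
  simp only [Pi.add_apply, Pi.sub_apply]; ring

theorem energy_add_left {f g u : G.V → ℝ} (hf : G.FiniteEnergy f) (hg : G.FiniteEnergy g)
    (hu : G.FiniteEnergy u) : G.energy (f + g) u = G.energy f u + G.energy g u := by
  unfold energy
  rw [← mul_add, ← (summable_energy hf hu).tsum_add (summable_energy hg hu)]
  refine congrArg _ (tsum_congr fun p => ?_)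
  simp only [Pi.add_apply]; ring

theorem energy_smul_left (r : ℝ) (f u : G.V → ℝ) :
    G.energy (r • f) u = r * G.energy f u := by
  unfold energy
  rw [mul_left_comm]
  refine congrArg ((1 / 2 : ℝ) * ·) ?_
  rw [← tsum_mul_left]
  refine tsum_congr fun p => ?_
  simp only [Pi.smul_apply, smul_eq_mul]; ring

theorem energy_sub_left {f g u : G.V → ℝ} (hf : G.FiniteEnergy f) (hg : G.FiniteEnergy g)
    (hu : G.FiniteEnergy u) : G.energy (f - g) u = G.energy f u - G.energy g u := by
  have h : f - g = f + (-1 : ℝ) • g := by rw [neg_one_smul, sub_eq_add_neg]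
  rw [h, energy_add_left hf (hg.smul _) hu, energy_smul_left]; ring

theorem energy_add_self {f g : G.V → ℝ} (hf : G.FiniteEnergy f) (hg : G.FiniteEnergy g) :
    G.energy (f + g) (f + g) = G.energy f f + 2 * G.energy f g + G.energy g g := by
  rw [energy_add_left hf hg (hf.add hg), energy_symm f, energy_symm g,
    energy_add_left hf hg hf, energy_add_left hf hg hg, energy_symm g f]; ring

theorem energy_sub_self {f g : G.V → ℝ} (hf : G.FiniteEnergy f) (hg : G.FiniteEnergy g) :
    G.energy (f - g) (f - g) = G.energy f f - 2 * G.energy f g + G.energy g g := by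
  rw [energy_sub_left hf hg (hf.sub hg), energy_symm f, energy_symm g,
    energy_sub_left hf hg hf, energy_sub_left hf hg hg, energy_symm g f]; ring

theorem energy_self (f : G.V → ℝ) :
    G.energy f f = (1 / 2) * ∑' p : G.V × G.V, G.c p.1 p.2 * (f p.1 - f p.2) ^ 2 := by
  unfold energy
  congr 1
  exact tsum_congr fun p => by ring

theorem energy_self_nonneg (f : G.V → ℝ) : 0 ≤ G.energy f f := by
  rw [energy_self]
  exact mul_nonneg (by norm_num)
    (tsum_nonneg fun p => mul_nonneg (G.c_nonneg _ _) (sq_nonneg _))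

theorem energy_le_of_contraction {f g : G.V → ℝ} (hf : G.FiniteEnergy f)
    (h : ∀ x y, |g x - g y| ≤ |f x - f y|) : G.energy g g ≤ G.energy f f := by
  rw [energy_self, energy_self]
  refine mul_le_mul_of_nonneg_left ?_ (by norm_num)
  exact (hf.of_contraction h).tsum_le_tsum
    (fun _ => mul_le_mul_of_nonneg_left (sq_le_sq.2 (h _ _)) (G.c_nonneg _ _)) hf

theorem edge_le_energy {f : G.V → ℝ} (hf : G.FiniteEnergy f) (x y : G.V) :
    G.c x y * (f x - f y) ^ 2 ≤ 2 * G.energy f f := by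
  rw [energy_self]
  have := hf.le_tsum (x, y) (fun p _ => mul_nonneg (G.c_nonneg _ _) (sq_nonneg _))
  simp only at this
  linarith

theorem exists_sq_le (x y : G.V) :
    ∃ C : ℝ, 0 ≤ C ∧ ∀ f, G.FiniteEnergy f → (f x - f y) ^ 2 ≤ C * G.energy f f := by
  obtain ⟨w⟩ := G.connected.preconnected x y
  induction w with
  | nil => exact ⟨0, le_rfl, fun f _ => by simp⟩
  | @cons u v w h _ ih =>
    obtain ⟨C, hC, hf⟩ := ih
    have hc : 0 < G.c u v := (G.c_pos_iff u v).2 h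
    refine ⟨2 * (2 / G.c u v) + 2 * C, by positivity, fun f hE => ?_⟩
    have h1 : (f u - f v) ^ 2 ≤ 2 / G.c u v * G.energy f f := by
      rw [div_mul_eq_mul_div, le_div_iff₀ hc]
      linarith [edge_le_energy hE u v]
    nlinarith [hf f hE, sq_nonneg ((f u - f v) - (f v - f w))]

/-! ### The resistance metric is a metric -/

theorem bddAbove_resistance (x y : G.V) : BddAbove {r : ℝ | ∃ f, G.FiniteEnergy f ∧
    0 < G.energy f f ∧ r = |f x - f y| ^ 2 / G.energy f f} := by
  obtain ⟨C, -, hC⟩ := G.exists_sq_le x y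
  refine ⟨C, ?_⟩
  rintro r ⟨f, hf, hpos, rfl⟩
  rw [div_le_iff₀ hpos, sq_abs]
  exact hC f hf

theorem resistance_nonneg (x y : G.V) : 0 ≤ G.resistance x y := by
  refine Real.sSup_nonneg ?_
  rintro r ⟨f, -, hpos, rfl⟩
  positivity

theorem sq_le_resistance {f : G.V → ℝ} (hf : G.FiniteEnergy f) (x y : G.V) :
    (f x - f y) ^ 2 ≤ G.resistance x y * G.energy f f := by
  rcases (energy_self_nonneg f).eq_or_lt with h | h
  · obtain ⟨C, -, hC⟩ := G.exists_sq_le x y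
    have := hC f hf
    rw [← h] at this ⊢
    simpa using this
  · rw [← sq_abs, ← div_le_iff₀ h]
    exact le_csSup (bddAbove_resistance x y) ⟨f, hf, h, rfl⟩

theorem resistance_le {x y : G.V} {C : ℝ} (hC : 0 ≤ C)
    (h : ∀ f, G.FiniteEnergy f → (f x - f y) ^ 2 ≤ C * G.energy f f) :
    G.resistance x y ≤ C := by
  refine Real.sSup_le ?_ hC
  rintro r ⟨f, hf, hpos, rfl⟩
  rw [div_le_iff₀ hpos, sq_abs]
  exact h f hf

theorem resistance_self (x : G.V) : G.resistance x x = 0 :=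
  le_antisymm (resistance_le le_rfl fun f _ => by simp) (resistance_nonneg x x)

theorem resistance_comm (x y : G.V) : G.resistance x y = G.resistance y x := by
  unfold resistance
  simp only [abs_sub_comm]

theorem resistance_triangle (x y z : G.V) :
    G.resistance x z ≤ G.resistance x y + G.resistance y z := by
  have h1 := resistance_nonneg x y
  have h2 := resistance_nonneg y z
  have key : ∀ f, G.FiniteEnergy f → f z ≤ f x →
      (f x - f z) ^ 2 ≤ (G.resistance x y + G.resistance y z) * G.energy f f := by
    intro f hf hzx
    have hE := energy_self_nonneg f
    rcases le_total (f y) (f z) with hy | hy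
    · have := sq_le_resistance hf x y
      nlinarith [mul_nonneg h2 hE]
    rcases le_total (f x) (f y) with hy' | hy'
    · have := sq_le_resistance hf y z
      nlinarith [mul_nonneg h1 hE]
    set t := f y with ht
    let u : G.V → ℝ := fun v => max (f v) t
    let w : G.V → ℝ := fun v => min (f v) t
    have hu : G.FiniteEnergy u := hf.of_contraction fun a b => abs_max_sub_max_le_abs _ _ _
    have hw : G.FiniteEnergy w := hf.of_contraction fun a b => abs_min_sub_min_le_max _ _ _ _ |>.trans (by simp)
    have hsum : G.energy u u + G.energy w w ≤ G.energy f f := by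
      rw [energy_self, energy_self, energy_self, ← mul_add]
      refine mul_le_mul_of_nonneg_left ?_ (by norm_num)
      rw [← hu.tsum_add hw]
      refine (Summable.add hu hw).tsum_le_tsum (fun p => ?_) hf
      rw [← mul_add]
      refine mul_le_mul_of_nonneg_left ?_ (G.c_nonneg _ _)
      simp only [u, w]
      rcases le_total (f p.1) t with h3 | h3 <;> rcases le_total (f p.2) t with h4 | h4 <;>
        simp only [h3, h4, max_eq_left, max_eq_right, min_eq_left, min_eq_right] <;> nlinarith
    have hux := sq_le_resistance hu x y
    have hwx := sq_le_resistance hw y z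
    have e1 : u x - u y = f x - t := by simp [u, ← ht, hy']
    have e2 : w y - w z = t - f z := by simp [w, ← ht, hy]
    rw [e1] at hux
    rw [e2] at hwx
    have hEu := energy_self_nonneg u
    have hEw := energy_self_nonneg w
    generalize G.energy u u = A at *
    generalize G.energy w w = B at *
    generalize G.resistance x y = P at *
    generalize G.resistance y z = Q at *
    have hab : ((f x - t) * (t - f z)) ^ 2 ≤ (P * B) * (Q * A) := by
      rw [mul_pow]
      calc (f x - t) ^ 2 * (t - f z) ^ 2 ≤ (P * A) * (Q * B) :=
            mul_le_mul hux hwx (sq_nonneg _) (mul_nonneg h1 hEu)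
        _ = _ := by ring
    have hcross : 2 * ((f x - t) * (t - f z)) ≤ P * B + Q * A := by
      refine abs_le_of_sq_le_sq' ?_ (by positivity) |>.2
      nlinarith [sq_nonneg (P * B - Q * A)]
    calc (f x - f z) ^ 2 = (f x - t) ^ 2 + 2 * ((f x - t) * (t - f z)) + (t - f z) ^ 2 := by ring
      _ ≤ (P + Q) * (A + B) := by nlinarith
      _ ≤ (P + Q) * G.energy f f := mul_le_mul_of_nonneg_left hsum (by positivity)
  refine resistance_le (by positivity) fun f hf => ?_
  rcases le_total (f z) (f x) with h | h
  · exact key f hf h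
  · have h3 := key ((-1 : ℝ) • f) (hf.smul _) (by simpa using h)
    rw [energy_smul_left, energy_symm, energy_smul_left] at h3
    simp only [Pi.smul_apply, smul_eq_mul] at h3
    nlinarith

/-- The indicator function of a vertex. -/
noncomputable def ind (x : G.V) : G.V → ℝ := Set.indicator {x} 1

@[simp] theorem ind_self (x : G.V) : ind x x = 1 := by simp [ind]

theorem ind_of_ne {x y : G.V} (h : y ≠ x) : ind x y = 0 := by simp [ind, h]

theorem summable_fst {g : G.V → G.V → ℝ} (x : G.V) (hg : Summable (g x)) :
    Summable fun p : G.V × G.V => g p.1 p.2 * ind x p.1 := by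
  have hinj : Function.Injective (fun y : G.V => (x, y)) := fun a b h => (Prod.ext_iff.1 h).2
  rw [← hinj.summable_iff]
  · simpa [Function.comp_def] using hg
  · rintro ⟨a, b⟩ hab
    have : a ≠ x := by
      rintro rfl
      exact hab ⟨b, rfl⟩
    simp [ind_of_ne this]

theorem tsum_fst {g : G.V → G.V → ℝ} (x : G.V) :
    ∑' p : G.V × G.V, g p.1 p.2 * ind x p.1 = ∑' y, g x y := by
  have hinj : Function.Injective (fun y : G.V => (x, y)) := fun a b h => (Prod.ext_iff.1 h).2
  rw [← hinj.tsum_eq]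
  · simp
  · rintro ⟨a, b⟩ hab
    have : a = x := by
      by_contra h
      exact hab (by simp [ind_of_ne h])
    exact ⟨b, by simp [this]⟩

theorem finiteEnergy_ind (x : G.V) : G.FiniteEnergy (ind x) := by
  have h1 := summable_fst x (G.summable_c x)
  have h2 := (Equiv.prodComm G.V G.V).summable_iff.2 h1
  refine Summable.of_nonneg_of_le (fun _ => mul_nonneg (G.c_nonneg _ _) (sq_nonneg _))
    (fun p => ?_) (h1.add h2)
  have hc := G.c_nonneg p.1 p.2
  simp only [Function.comp_apply, Equiv.prodComm_apply, Prod.fst_swap, Prod.snd_swap,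
    G.c_symm p.2 p.1]
  by_cases ha : p.1 = x <;> by_cases hb : p.2 = x <;> simp [ha, hb, ind_of_ne, G.c_self]

theorem one_le_resistance_mul {x y : G.V} (h : x ≠ y) :
    1 ≤ G.resistance x y * G.energy (ind x) (ind x) := by
  have := sq_le_resistance (finiteEnergy_ind x) x y
  rwa [ind_self, ind_of_ne h.symm, sub_zero, one_pow] at this

theorem resistance_pos {x y : G.V} (h : x ≠ y) : 0 < G.resistance x y := by
  refine (resistance_nonneg x y).lt_of_ne fun h0 => ?_
  have := one_le_resistance_mul h
  rw [← h0] at this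
  norm_num at this

theorem eq_of_resistance_eq_zero {x y : G.V} (h : G.resistance x y = 0) : x = y := by
  by_contra hne
  exact (resistance_pos hne).ne' h

/-! ### Harmonic extensions and traces -/

/-- `h` minimizes the energy among all functions of finite energy with boundary values `φ` on
`B`. -/
structure IsEnergyMinimizer (B : Set G.V) (φ : B → ℝ) (h : G.V → ℝ) : Prop where
  finiteEnergy : G.FiniteEnergy h
  eq_on : ∀ x : B, h x = φ x
  energy_le : ∀ u, G.FiniteEnergy u → (∀ x : B, u x = φ x) → G.energy h h ≤ G.energy u u

theorem IsEnergyMinimizer.orthogonal {B : Set G.V} {φ : B → ℝ} {h v : G.V → ℝ}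
    (hh : IsEnergyMinimizer B φ h) (hv : G.FiniteEnergy v) (hv0 : ∀ x ∈ B, v x = 0) :
    G.energy h v = 0 := by
  have key : ∀ t : ℝ, 0 ≤ 2 * t * G.energy h v + t ^ 2 * G.energy v v := by
    intro t
    have h1 := hh.energy_le (h + t • v) (hh.finiteEnergy.add (hv.smul t))
      (fun x => by simp [hv0 x x.2, hh.eq_on x])
    rw [energy_add_self hh.finiteEnergy (hv.smul t), energy_smul_left,
      energy_symm h (t • v), energy_smul_left, energy_symm v (t • v), energy_smul_left,
      energy_symm v h] at h1
    nlinarith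
  have hE := energy_self_nonneg v
  set e := G.energy h v
  set E := G.energy v v
  have h2 := key (-e / (E + 1))
  have h3 : 2 * (-e / (E + 1)) * e + (-e / (E + 1)) ^ 2 * E
      = -(e ^ 2 * (E + 2)) / (E + 1) ^ 2 := by
    field_simp; ring
  rw [h3, le_div_iff₀ (by positivity)] at h2
  nlinarith [mul_nonneg (sq_nonneg e) hE, sq_nonneg e]

theorem IsEnergyMinimizer.of_orthogonal {B : Set G.V} {φ : B → ℝ} {h : G.V → ℝ}
    (hh : G.FiniteEnergy h) (hφ : ∀ x : B, h x = φ x)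
    (horth : ∀ v, G.FiniteEnergy v → (∀ x ∈ B, v x = 0) → G.energy h v = 0) :
    IsEnergyMinimizer B φ h := by
  refine ⟨hh, hφ, fun u hu hu' => ?_⟩
  have h1 := horth (u - h) (hu.sub hh) (fun x hx => by
    simp [hu' ⟨x, hx⟩, hφ ⟨x, hx⟩])
  have h2 := energy_add_self hh (hu.sub hh)
  rw [add_sub_cancel, h1] at h2
  linarith [energy_self_nonneg (u - h)]

theorem IsEnergyMinimizer.unique {B : Set G.V} (hB : B.Nonempty) {φ : B → ℝ} {h k : G.V → ℝ}
    (hh : IsEnergyMinimizer B φ h) (hk : IsEnergyMinimizer B φ k) : h = k := by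
  obtain ⟨b, hb⟩ := hB
  have hd := hh.finiteEnergy.sub hk.finiteEnergy
  have hd0 : ∀ x ∈ B, (h - k) x = 0 := fun x hx => by
    simp [hh.eq_on ⟨x, hx⟩, hk.eq_on ⟨x, hx⟩]
  have h1 := energy_sub_left hh.finiteEnergy hk.finiteEnergy hd
  rw [hh.orthogonal hd hd0, hk.orthogonal hd hd0, sub_zero] at h1
  funext x
  have h2 := sq_le_resistance hd x b
  rw [h1, mul_zero, hd0 b hb, sub_zero] at h2
  have h3 := pow_eq_zero_iff (two_ne_zero) |>.1 (le_antisymm h2 (sq_nonneg _))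
  exact sub_eq_zero.1 h3

theorem exists_isEnergyMinimizer {B : Set G.V} (hB : B.Nonempty) {φ : B → ℝ}
    (hφ : ∃ u, G.FiniteEnergy u ∧ ∀ x : B, u x = φ x) : ∃ h, IsEnergyMinimizer B φ h := by
  obtain ⟨b, hb⟩ := hB
  set S : Set ℝ := {e | ∃ u, G.FiniteEnergy u ∧ (∀ x : B, u x = φ x) ∧ e = G.energy u u} with hS
  have hne : S.Nonempty := by
    obtain ⟨u, hu, hu'⟩ := hφ
    exact ⟨_, u, hu, hu', rfl⟩
  have hbdd : BddBelow S := ⟨0, by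
    rintro e ⟨u, -, -, rfl⟩
    exact energy_self_nonneg u⟩
  set I := sInf S with hI
  have hseq : ∀ n : ℕ, ∃ u, G.FiniteEnergy u ∧ (∀ x : B, u x = φ x) ∧
      G.energy u u < I + 1 / ((n : ℝ) + 1) := by
    intro n
    obtain ⟨e, ⟨u, hu, hu', rfl⟩, hlt⟩ :=
      exists_lt_of_csInf_lt hne (lt_add_of_pos_right I (Nat.one_div_pos_of_nat (n := n)))
    exact ⟨u, hu, hu', hlt⟩
  choose u hu hu' hlt using hseq
  have hlow : ∀ v, G.FiniteEnergy v → (∀ x : B, v x = φ x) → I ≤ G.energy v v :=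
    fun v hv hv' => csInf_le hbdd ⟨v, hv, hv', rfl⟩
  have hcau : ∀ m n, G.energy (u m - u n) (u m - u n)
      ≤ 2 / ((m : ℝ) + 1) + 2 / ((n : ℝ) + 1) := by
    intro m n
    have h1 := energy_add_self (hu m) (hu n)
    have h2 := energy_sub_self (hu m) (hu n)
    have h3 := hlow ((1 / 2 : ℝ) • (u m + u n)) (((hu m).add (hu n)).smul _) (fun x => by
      simp only [Pi.smul_apply, Pi.add_apply, smul_eq_mul, hu' m x, hu' n x]; ring)
    rw [energy_smul_left, energy_symm, energy_smul_left] at h3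
    have h4 := hlt m
    have h5 := hlt n
    have e1 : 2 / ((m : ℝ) + 1) = 2 * (1 / ((m : ℝ) + 1)) := by ring
    have e2 : 2 / ((n : ℝ) + 1) = 2 * (1 / ((n : ℝ) + 1)) := by ring
    rw [e1, e2]
    linarith
  have hpt : ∀ x, CauchySeq fun n => u n x := by
    intro x
    rw [Metric.cauchySeq_iff]
    intro ε hε
    have hR := resistance_nonneg x b
    have hlim : Tendsto (fun n : ℕ => G.resistance x b * (4 * (1 / ((n : ℝ) + 1)))) atTop
        (𝓝 (G.resistance x b * (4 * 0))) :=
      (tendsto_one_div_add_atTop_nhds_zero_nat.const_mul 4).const_mul _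
    rw [mul_zero, mul_zero] at hlim
    obtain ⟨N, hN⟩ := ((tendsto_order.1 hlim).2 (ε ^ 2) (by positivity)).exists
    refine ⟨N, fun m hm n hn => ?_⟩
    have h1 := sq_le_resistance ((hu m).sub (hu n)) x b
    have hbm := hu' m ⟨b, hb⟩
    have hbn := hu' n ⟨b, hb⟩
    simp only [Pi.sub_apply] at h1 hbm hbn
    rw [hbm, hbn, sub_self, sub_zero] at h1
    have hm' : 2 / ((m : ℝ) + 1) ≤ 2 / ((N : ℝ) + 1) := by gcongr
    have hn' : 2 / ((n : ℝ) + 1) ≤ 2 / ((N : ℝ) + 1) := by gcongr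
    have h2 : G.energy (u m - u n) (u m - u n) ≤ 4 * (1 / ((N : ℝ) + 1)) := by
      have e1 : 4 * (1 / ((N : ℝ) + 1)) = 2 / ((N : ℝ) + 1) + 2 / ((N : ℝ) + 1) := by ring
      rw [e1]
      linarith [hcau m n]
    rw [Real.dist_eq]
    refine abs_lt_of_sq_lt_sq ?_ hε.le
    exact (h1.trans (mul_le_mul_of_nonneg_left h2 hR)).trans_lt hN
  choose h hh using fun x => cauchySeq_tendsto_of_complete (hpt x)
  have hbound : ∀ s : Finset (G.V × G.V),
      ∑ p ∈ s, G.c p.1 p.2 * (h p.1 - h p.2) ^ 2 ≤ 2 * I := by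
    intro s
    have hl : Tendsto (fun n => ∑ p ∈ s, G.c p.1 p.2 * (u n p.1 - u n p.2) ^ 2) atTop
        (𝓝 (∑ p ∈ s, G.c p.1 p.2 * (h p.1 - h p.2) ^ 2)) :=
      tendsto_finsetSum _ fun p _ => (((hh p.1).sub (hh p.2)).pow 2).const_mul _
    have hr : Tendsto (fun n : ℕ => 2 * (I + 1 / ((n : ℝ) + 1))) atTop (𝓝 (2 * (I + 0))) :=
      (tendsto_one_div_add_atTop_nhds_zero_nat.const_add I).const_mul 2
    rw [add_zero] at hr
    refine le_of_tendsto_of_tendsto' hl hr fun n => ?_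
    have h1 : ∑ p ∈ s, G.c p.1 p.2 * (u n p.1 - u n p.2) ^ 2
        ≤ ∑' p : G.V × G.V, G.c p.1 p.2 * (u n p.1 - u n p.2) ^ 2 :=
      Summable.sum_le_tsum s (fun p _ => mul_nonneg (G.c_nonneg _ _) (sq_nonneg _)) (hu n)
    have h2 := energy_self (u n)
    linarith [hlt n]
  have hfin : G.FiniteEnergy h :=
    summable_of_sum_le (fun p => mul_nonneg (G.c_nonneg _ _) (sq_nonneg _)) hbound
  refine ⟨h, hfin, fun x => tendsto_nhds_unique (hh x) ?_, fun v hv hv' => ?_⟩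
  · simp only [hu' _ x]
    exact tendsto_const_nhds
  · refine le_trans ?_ (hlow v hv hv')
    have h1 := Summable.tsum_le_of_sum_le hfin hbound
    rw [energy_self]
    linarith

open Classical in
/-- The harmonic extension of `φ : B → ℝ`, that is, the unique minimizer of the energy among the
functions of finite energy that agree with `φ` on `B` (it exists as soon as `B` is non-empty and
there is one such function, see `exists_isEnergyMinimizer` and `IsEnergyMinimizer.unique`). -/
noncomputable def harmonicExt (B : Set G.V) (φ : B → ℝ) : G.V → ℝ :=
  if h : ∃ u, IsEnergyMinimizer B φ u then h.choose else 0

/-- The trace of the form on `B`. -/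
noncomputable def traceForm (B : Set G.V) (φ ψ : B → ℝ) : ℝ :=
  G.energy (harmonicExt B φ) (harmonicExt B ψ)

open Classical in
/-- The conductances of the trace on `B`. -/
noncomputable def traceC (B : Set G.V) (x y : B) : ℝ :=
  if x = y then 0 else -traceForm B (Set.indicator {x} 1) (Set.indicator {y} 1)

theorem energy_ind_eq {f : G.V → ℝ} (hf : G.FiniteEnergy f) (x : G.V) :
    Summable (fun z => G.c x z * (f x - f z)) ∧
      G.energy f (ind x) = ∑' z, G.c x z * (f x - f z) := by
  have hinj : Function.Injective (fun y : G.V => (x, y)) := fun a b h => (Prod.ext_iff.1 h).2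
  have hs : Summable (fun z => G.c x z * (f x - f z)) := by
    refine Summable.of_norm_bounded ((G.summable_c x).add (hf.comp_injective hinj)) fun z => ?_
    have hc := G.c_nonneg x z
    simp only [Function.comp_apply, Real.norm_eq_abs, abs_mul, abs_of_nonneg hc]
    rw [← sq_abs (f x - f z)]
    nlinarith [sq_nonneg (|f x - f z| - 1), abs_nonneg (f x - f z),
      mul_nonneg hc (sq_nonneg (|f x - f z| - 1))]
  refine ⟨hs, ?_⟩
  let g : G.V → G.V → ℝ := fun a b => G.c a b * (f a - f b)
  have h1 := summable_fst (g := g) x hs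
  have h2 := (Equiv.prodComm G.V G.V).summable_iff.2 h1
  have h3 := (Equiv.prodComm G.V G.V).tsum_eq (fun p : G.V × G.V => g p.1 p.2 * ind x p.1)
  have h4 : ∀ p : G.V × G.V, G.c p.1 p.2 * (f p.1 - f p.2) * (ind x p.1 - ind x p.2)
      = g p.1 p.2 * ind x p.1 +
        ((fun p : G.V × G.V => g p.1 p.2 * ind x p.1) ∘ Equiv.prodComm G.V G.V) p := by
    intro p
    simp only [Function.comp_apply, Equiv.prodComm_apply, Prod.fst_swap, Prod.snd_swap, g,
      G.c_symm p.2 p.1]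
    ring
  unfold energy
  rw [tsum_congr h4, h1.tsum_add h2]
  simp only [Function.comp_apply] at *
  rw [h3, tsum_fst]
  ring

theorem indicator_coe (B : Set G.V) (x y : B) :
    Set.indicator {x} (1 : B → ℝ) y = ind (x : G.V) (y : G.V) := by
  by_cases h : y = x
  · simp [h]
  · rw [ind_of_ne (fun h' => h (Subtype.ext h'))]
    simp [h]

theorem harmonicExt_spec {B : Set G.V} (hB : B.Nonempty) {φ : B → ℝ}
    (hφ : ∃ u, G.FiniteEnergy u ∧ ∀ x : B, u x = φ x) :
    IsEnergyMinimizer B φ (harmonicExt B φ) := by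
  have h := exists_isEnergyMinimizer hB hφ
  rw [harmonicExt, dif_pos h]
  exact h.choose_spec

theorem harmonicExt_ind_spec {B : Set G.V} (x : B) :
    IsEnergyMinimizer B (Set.indicator {x} 1) (harmonicExt B (Set.indicator {x} 1)) :=
  harmonicExt_spec ⟨x, x.2⟩ ⟨ind x, finiteEnergy_ind _, fun y => (indicator_coe B x y).symm⟩

theorem IsEnergyMinimizer.nonneg {B : Set G.V} (hB : B.Nonempty) {φ : B → ℝ} {h : G.V → ℝ}
    (hh : IsEnergyMinimizer B φ h) (hφ : ∀ x, 0 ≤ φ x) (z : G.V) : 0 ≤ h z := by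
  let k : G.V → ℝ := fun v => max (h v) 0
  have hc : ∀ x y, |k x - k y| ≤ |h x - h y| := fun x y => abs_max_sub_max_le_abs _ _ _
  have hk : IsEnergyMinimizer B φ k :=
    ⟨hh.finiteEnergy.of_contraction hc, fun x => by simp [k, hh.eq_on x, hφ x],
      fun u hu hu' => (energy_le_of_contraction hh.finiteEnergy hc).trans (hh.energy_le u hu hu')⟩
  rw [hh.unique hB hk]
  exact le_max_right _ _

theorem IsEnergyMinimizer.le_one {B : Set G.V} (hB : B.Nonempty) {φ : B → ℝ} {h : G.V → ℝ}
    (hh : IsEnergyMinimizer B φ h) (hφ : ∀ x, φ x ≤ 1) (z : G.V) : h z ≤ 1 := by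
  let k : G.V → ℝ := fun v => min (h v) 1
  have hc : ∀ x y, |k x - k y| ≤ |h x - h y| :=
    fun x y => abs_min_sub_min_le_max _ _ _ _ |>.trans (by simp)
  have hk : IsEnergyMinimizer B φ k :=
    ⟨hh.finiteEnergy.of_contraction hc, fun x => by simp [k, hh.eq_on x, hφ x],
      fun u hu hu' => (energy_le_of_contraction hh.finiteEnergy hc).trans (hh.energy_le u hu hu')⟩
  rw [hh.unique hB hk]
  exact min_le_right _ _

/-- The function `h_y`, the harmonic extension of the indicator of `y ∈ B`. -/
noncomputable def hext (B : Set G.V) (y : B) : G.V → ℝ := harmonicExt B (Set.indicator {y} 1)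

theorem hext_spec {B : Set G.V} (y : B) :
    IsEnergyMinimizer B (Set.indicator {y} 1) (hext B y) := harmonicExt_ind_spec y

theorem hext_apply {B : Set G.V} (y x : B) : hext B y x = ind (y : G.V) (x : G.V) := by
  rw [(hext_spec y).eq_on x, indicator_coe]

theorem hext_nonneg {B : Set G.V} (y : B) (z : G.V) : 0 ≤ hext B y z :=
  (hext_spec y).nonneg ⟨y, y.2⟩ (fun x => Set.indicator_nonneg (fun _ _ => zero_le_one) x) z

theorem traceC_eq {B : Set G.V} {x y : B} (h : x ≠ y) :
    Summable (fun z => G.c x z * hext B y z) ∧ traceC B x y = ∑' z, G.c x z * hext B y z := by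
  have hne : (x : G.V) ≠ y := fun h' => h (Subtype.ext h')
  have hy := (hext_spec y).finiteEnergy
  have hx := (hext_spec x).finiteEnergy
  have hyx : hext B y x = 0 := by rw [hext_apply, ind_of_ne hne]
  obtain ⟨hs, he⟩ := energy_ind_eq hy (x : G.V)
  simp only [hyx, zero_sub, mul_neg] at hs he
  refine ⟨by simpa using hs.neg, ?_⟩
  have h1 := (hext_spec y).orthogonal (hx.sub (finiteEnergy_ind (x : G.V)))
    (fun b hb => by
      have := hext_apply x ⟨b, hb⟩
      simp only at this
      simp [this])
  rw [energy_symm, energy_sub_left hx (finiteEnergy_ind _) hy, sub_eq_zero, energy_symm _ (hext B y),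
    energy_symm _ (hext B y), he, tsum_neg] at h1
  rw [traceC, if_neg h, traceForm, energy_symm]
  change -G.energy (hext B y) (hext B x) = _
  rw [h1, neg_neg]

theorem traceC_symm (B : Set G.V) (x y : B) : traceC B x y = traceC B y x := by
  unfold traceC traceForm
  rw [energy_symm]
  by_cases h : x = y
  · simp [h]
  · rw [if_neg h, if_neg (Ne.symm h)]

theorem traceC_self (B : Set G.V) (x : B) : traceC B x x = 0 := by simp [traceC]

theorem traceC_nonneg (B : Set G.V) (x y : B) : 0 ≤ traceC B x y := by
  by_cases h : x = y
  · subst h; rw [traceC_self]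
  · rw [(traceC_eq h).2]
    exact tsum_nonneg fun z => mul_nonneg (G.c_nonneg _ _) (hext_nonneg _ _)

theorem sum_hext_le_one {B : Set G.V} (hB : B.Nonempty) (s : Finset B) (z : G.V) :
    ∑ y ∈ s, hext B y z ≤ 1 := by
  classical
  have hspec : IsEnergyMinimizer B (Set.indicator (s : Set B) 1) (∑ y ∈ s, hext B y) := by
    have hfin : ∀ t : Finset B, G.FiniteEnergy (∑ y ∈ t, hext B y) ∧
        ∀ v, G.FiniteEnergy v → (∀ x ∈ B, v x = 0) → G.energy (∑ y ∈ t, hext B y) v = 0 := by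
      intro t
      induction t using Finset.induction_on with
      | empty =>
        refine ⟨by rw [Finset.sum_empty]; exact finiteEnergy_const (G := G) 0, fun v _ _ => ?_⟩
        simp [energy]
      | insert a t ha ih =>
        rw [Finset.sum_insert ha]
        refine ⟨(hext_spec a).finiteEnergy.add ih.1, fun v hv hv0 => ?_⟩
        rw [energy_add_left (hext_spec a).finiteEnergy ih.1 hv, ih.2 v hv hv0,
          (hext_spec a).orthogonal hv hv0, add_zero]
    refine IsEnergyMinimizer.of_orthogonal (hfin s).1 (fun x => ?_) (hfin s).2
    rw [Finset.sum_apply]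
    by_cases hx : x ∈ s
    · rw [Finset.sum_eq_single_of_mem x hx, hext_apply]
      · simp [hx]
      · intro y _ hyx
        rw [hext_apply, ind_of_ne fun h => hyx (Subtype.ext h.symm)]
    · rw [Finset.sum_eq_zero]
      · simp [hx]
      · intro y hy
        rw [hext_apply, ind_of_ne]
        rintro h
        exact hx (Subtype.ext h ▸ hy)
  have := hspec.le_one hB (fun x => Set.indicator_le_self' (fun _ _ => zero_le_one) x) z
  simpa using this

theorem summable_traceC (B : Set G.V) (x : B) : Summable (traceC B x) := by
  classical
  refine summable_of_sum_le (c := G.cTot x) (fun y => traceC_nonneg B x y) fun s => ?_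
  rw [← Finset.sum_erase s (traceC_self B x)]
  have h1 : ∀ y ∈ s.erase x, Summable (fun z => G.c x z * hext B y z) :=
    fun y hy => (traceC_eq (Finset.ne_of_mem_erase hy).symm).1
  rw [Finset.sum_congr rfl fun y hy => (traceC_eq (Finset.ne_of_mem_erase hy).symm).2,
    ← Summable.tsum_finsetSum h1]
  refine Summable.tsum_le_tsum (fun z => ?_) (summable_sum h1) (G.summable_c x)
  rw [← Finset.mul_sum]
  exact mul_le_of_le_one_right (G.c_nonneg _ _) (sum_hext_le_one ⟨x, x.2⟩ _ z)

/-- The graph of the trace: `x` and `y` are adjacent iff the trace conductance is positive. -/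
noncomputable def traceGraph (B : Set G.V) : SimpleGraph B where
  Adj x y := 0 < traceC B x y
  symm := ⟨fun x y h => by rwa [traceC_symm]⟩
  loopless := ⟨fun x h => by simp [traceC_self] at h⟩

theorem traceGraph_preconnected (B : Set G.V) : (traceGraph B).Preconnected := by
  intro a b
  have key : ∀ z : G.V, ∃ y : B, (traceGraph B).Reachable a y ∧ 0 < hext B y z := by
    intro z
    obtain ⟨w⟩ := G.connected.preconnected z a
    have gen : ∀ u v : G.V, G.graph.Walk u v →
        (∃ y : B, (traceGraph B).Reachable a y ∧ 0 < hext B y v) →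
        ∃ y : B, (traceGraph B).Reachable a y ∧ 0 < hext B y u := by
      intro u v w
      induction w with
      | nil => exact id
      | @cons u v _ hadj _ ih =>
        intro hP
        obtain ⟨y, hy, hpos⟩ := ih hP
        have hterm : 0 < G.c u v * hext B y v := mul_pos ((G.c_pos_iff u v).2 hadj) hpos
        by_cases hu : u ∈ B
        · by_cases huy : (⟨u, hu⟩ : B) = y
          · refine ⟨y, hy, ?_⟩
            have := hext_apply y y
            rw [ind_self] at this
            rw [← huy] at this ⊢
            simp only at this
            rw [this]; exact one_pos
          · refine ⟨⟨u, hu⟩, hy.trans (SimpleGraph.Adj.reachable ?_).symm, ?_⟩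
            · change 0 < traceC B ⟨u, hu⟩ y
              obtain ⟨h1, h2⟩ := traceC_eq huy
              rw [h2]
              exact h1.tsum_pos (fun z => mul_nonneg (G.c_nonneg _ _) (hext_nonneg _ _)) v hterm
            · have := hext_apply (⟨u, hu⟩ : B) ⟨u, hu⟩
              simp only [ind_self] at this
              rw [this]; exact one_pos
        · refine ⟨y, hy, (hext_nonneg y u).lt_of_ne fun h0 => ?_⟩
          obtain ⟨h1, h2⟩ := energy_ind_eq (hext_spec y).finiteEnergy u
          rw [(hext_spec y).orthogonal (finiteEnergy_ind u)
            (fun x hx => ind_of_ne (fun h => hu (h ▸ hx))), ← h0] at h2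
          simp only [← h0, zero_sub, mul_neg, tsum_neg] at h1 h2
          have h3 := (summable_neg_iff.1 h1).tsum_pos
            (fun z => mul_nonneg (G.c_nonneg _ _) (hext_nonneg _ _)) v hterm
          linarith
    refine gen z a w ⟨a, SimpleGraph.Reachable.refl _, ?_⟩
    rw [hext_apply, ind_self]
    exact one_pos
  obtain ⟨y, hy, hpos⟩ := key b
  rw [hext_apply] at hpos
  by_cases h : (b : G.V) = y
  · rwa [Subtype.ext h]
  · rw [ind_of_ne h] at hpos
    exact absurd hpos (lt_irrefl _)

/-- The trace `G|_B` of an electrical network onto a non-empty set of vertices `B`: the network on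
`B` with conductances `c(x, y) = -ℰ|_B(1_x, 1_y)` for `x ≠ y`. -/
noncomputable def trace (G : ElectricalNetwork) (B : Set G.V) (hB : B.Nonempty) :
    ElectricalNetwork where
  V := B
  countable := haveI := G.countable; inferInstance
  graph := traceGraph B
  connected := haveI := hB.to_subtype; ⟨traceGraph_preconnected B⟩
  c := traceC B
  c_nonneg := traceC_nonneg B
  c_symm := traceC_symm B
  c_pos_iff _ _ := Iff.rfl
  summable_c := summable_traceC B

/-- The vertex set with the resistance metric. -/
@[reducible]
noncomputable def resistanceMetric (G : ElectricalNetwork) : MetricSpace G.V where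
  dist x y := G.resistance x y
  dist_self := resistance_self
  dist_comm := resistance_comm
  dist_triangle := resistance_triangle
  eq_of_dist_eq_zero := eq_of_resistance_eq_zero

/-- The vertex set with the scaled resistance metric `a⁻¹ R`. -/
@[reducible]
noncomputable def scaledMetric (G : ElectricalNetwork) (a : ℝ) (ha : 0 < a) : MetricSpace G.V where
  dist x y := a⁻¹ * G.resistance x y
  dist_self x := by rw [resistance_self, mul_zero]
  dist_comm x y := by rw [resistance_comm]
  dist_triangle x y z := by
    rw [← mul_add]
    exact mul_le_mul_of_nonneg_left (resistance_triangle x y z) (inv_pos.2 ha).le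
  eq_of_dist_eq_zero h :=
    eq_of_resistance_eq_zero ((mul_eq_zero.1 h).resolve_left (inv_pos.2 ha).ne')

/-- The scaled measure `b⁻¹ μ`, where `μ(A) = ∑_{x ∈ A} c(x)`. -/
noncomputable def scaledMeasure (G : ElectricalNetwork) [MeasurableSpace G.V] (b : ℝ) :
    Measure G.V :=
  ENNReal.ofReal b⁻¹ • Measure.sum fun x => ENNReal.ofReal (G.cTot x) • Measure.dirac x

/-- The total scaled conductance `∑_{x ∈ A, y ∉ A} b⁻¹ c(x, y)` on the edges crossing over the
boundary of `A`. -/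
noncomputable def crossing (G : ElectricalNetwork) (b : ℝ) (A : Set G.V) : ℝ≥0∞ :=
  ∑' (x : A) (y : (Aᶜ : Set G.V)), ENNReal.ofReal (b⁻¹ * G.c x y)

theorem scaledMeasure_lt_top [MeasurableSpace G.V] (b : ℝ) {K : Set G.V} (hK : K.Finite)
    (hm : MeasurableSet K) : G.scaledMeasure b K < ⊤ := by
  classical
  rw [scaledMeasure, Measure.smul_apply, Measure.sum_apply _ hm, smul_eq_mul]
  refine ENNReal.mul_lt_top ENNReal.ofReal_lt_top ?_
  rw [tsum_eq_sum (s := hK.toFinset)]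
  · refine ENNReal.sum_lt_top.2 fun x _ => ?_
    rw [Measure.smul_apply, smul_eq_mul]
    exact ENNReal.mul_lt_top ENNReal.ofReal_lt_top (measure_lt_top _ _)
  · intro x hx
    have hx' : x ∉ K := fun h => hx (hK.mem_toFinset.2 h)
    rw [Measure.smul_apply, Measure.dirac_apply' _ hm, indicator_of_notMem hx', smul_zero]

theorem finite_of_isCompact {a : ℝ} (ha : 0 < a) {K : Set G.V}
    (hK : @IsCompact G.V (G.scaledMetric a ha).toUniformSpace.toTopologicalSpace K) :
    K.Finite := by
  let _ := G.scaledMetric a ha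
  have hd : DiscreteTopology G.V := by
    refine discreteTopology_iff_isOpen_singleton.2 fun x => Metric.isOpen_singleton_iff.2 ?_
    have hE : 0 < 1 + G.energy (ind x) (ind x) := by linarith [energy_self_nonneg (ind x)]
    refine ⟨a⁻¹ * (1 / (1 + G.energy (ind x) (ind x))), by positivity, fun y hy => ?_⟩
    by_contra hne
    have h1 := one_le_resistance_mul (Ne.symm hne)
    have h2 := resistance_nonneg x y
    have h3 : a⁻¹ * G.resistance y x < a⁻¹ * (1 / (1 + G.energy (ind x) (ind x))) := hy
    rw [resistance_comm] at h3
    have h4 := lt_of_mul_lt_mul_left h3 (inv_pos.2 ha).le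
    rw [lt_div_iff₀ hE] at h4
    linarith
  exact hK.finite_of_discrete

end ElectricalNetwork

/-- A rooted electrical network. -/
structure RootedNetwork extends ElectricalNetwork where
  root : V

/-- The resistance metric is boundedly compact and the resistance form is recurrent, that is,
`R(ρ, B(ρ, r)ᶜ) → ∞` as `r → ∞`. -/
def RootedNetwork.IsRecurrent (G : RootedNetwork) : Prop :=
  @ProperSpace G.V G.resistanceMetric.toPseudoMetricSpace ∧
    Tendsto (fun r : ℝ => G.resistanceSets {G.root} {x | G.resistance G.root x < r}ᶜ) atTop (𝓝 ⊤)

/-- Rooted metric spaces with a Borel measure that is finite on compact sets. -/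
structure RMSpace where
  carrier : Type
  [metric : MetricSpace carrier]
  [measurable : MeasurableSpace carrier]
  [borel : BorelSpace carrier]
  root : carrier
  μ : Measure carrier
  [finiteOnCompacts : IsFiniteMeasureOnCompacts μ]

attribute [instance] RMSpace.metric RMSpace.measurable RMSpace.borel RMSpace.finiteOnCompacts

/-- Boundedly compact: all closed balls are compact. -/
def RMSpace.BoundedlyCompact (X : RMSpace) : Prop := ProperSpace X.carrier

/-- Rooted-and-measured compact metric spaces (the measure is then finite). -/
structure CompactRMSpace extends RMSpace where
  [compact : CompactSpace carrier]

attribute [instance] CompactRMSpace.compact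

/-- The subspace carried by a compact set `K` that contains the root, with the restricted metric
and the restricted measure. -/
noncomputable def RMSpace.restrict (X : RMSpace) (K : Set X.carrier) (hK : IsCompact K)
    (hρ : X.root ∈ K) : CompactRMSpace where
  carrier := K
  root := ⟨X.root, hρ⟩
  μ := X.μ.comap Subtype.val
  finiteOnCompacts := ⟨fun C hC => by
    rw [(MeasurableEmbedding.subtype_coe hK.isClosed.measurableSet).comap_apply]
    exact (hC.image continuous_subtype_val).measure_lt_top⟩
  compact := isCompact_iff_compactSpace.1 hK

/-- The (pointed) Gromov-Hausdorff-Prohorov distance: the infimum, over all isometric embeddings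
into a common compact metric space, of the maximum of the distance of the roots, the Hausdorff
distance of the images and the Prohorov distance of the image measures. -/
noncomputable def dGHP (X Y : CompactRMSpace) : ℝ≥0∞ :=
  ⨅ (M : Type) (_ : MetricSpace M) (_ : CompactSpace M) (_ : MeasurableSpace M) (_ : BorelSpace M)
    (f : X.carrier → M) (g : Y.carrier → M) (_ : Isometry f) (_ : Isometry g),
    edist (f X.root) (g Y.root) ⊔ Metric.hausdorffEDist (range f) (range g) ⊔
      levyProkhorovEDist (X.μ.map f) (Y.μ.map g)

/-- The Gromov-Hausdorff-Prohorov topology, that is, the topology whose open sets are the unions of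
balls of the pseudometric `dGHP`. Spaces at distance `0` (those that differ by a root- and
measure-preserving isometry) are not identified; they have the same neighbourhoods and lie in the
same Borel sets. -/
instance : TopologicalSpace CompactRMSpace where
  IsOpen U := ∀ X ∈ U, ∃ ε > 0, ∀ Y, dGHP X Y < ε → Y ∈ U
  isOpen_univ := fun _ _ => ⟨1, one_pos, fun _ _ => mem_univ _⟩
  isOpen_inter := fun U W hU hW X hX => by
    obtain ⟨ε, hε, h⟩ := hU X hX.1
    obtain ⟨δ, hδ, h'⟩ := hW X hX.2
    exact ⟨min ε δ, lt_min hε hδ, fun Y hY =>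
      ⟨h Y (hY.trans_le (min_le_left _ _)), h' Y (hY.trans_le (min_le_right _ _))⟩⟩
  isOpen_sUnion := fun S hS X ⟨U, hU, hX⟩ => by
    obtain ⟨ε, hε, h⟩ := hS U hU X hX
    exact ⟨ε, hε, fun Y hY => ⟨U, hU, h Y hY⟩⟩

/-- The Borel `σ`-algebra of the Gromov-Hausdorff-Prohorov topology. -/
instance : MeasurableSpace CompactRMSpace := borel CompactRMSpace

instance : BorelSpace CompactRMSpace := ⟨rfl⟩

namespace RootedNetwork

/-- The scaled space `(V, a⁻¹ R, ρ, b⁻¹ μ)` of a rooted electrical network. -/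
noncomputable def scaled (G : RootedNetwork) (a b : ℝ) (ha : 0 < a) : RMSpace :=
  letI := G.scaledMetric a ha
  letI : MeasurableSpace G.V := borel G.V
  haveI : BorelSpace G.V := ⟨rfl⟩
  { carrier := G.V
    root := G.root
    μ := G.scaledMeasure b
    finiteOnCompacts := ⟨fun _ hK => ElectricalNetwork.scaledMeasure_lt_top b
      (ElectricalNetwork.finite_of_isCompact ha hK) hK.measurableSet⟩ }

/-- The trace onto a set of vertices that contains the root, with the same root. -/
noncomputable def trace (G : RootedNetwork) (B : Set G.V) (hρ : G.root ∈ B) : RootedNetwork where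
  toElectricalNetwork := G.toElectricalNetwork.trace B ⟨G.root, hρ⟩
  root := ⟨G.root, hρ⟩

/-- The scaled space `(K, a⁻¹ R', ρ, b⁻¹ μ')` of the trace `G|_K` onto a compact set `K` that
contains the root, where `R'` and `μ'` are the resistance metric and the measure of the network
`G|_K`. -/
noncomputable def scaledTrace (G : RootedNetwork) (a b : ℝ) (ha : 0 < a) (K : Set G.V)
    (hK : IsCompact (X := (G.scaled a b ha).carrier) K) (hρ : G.root ∈ K) : CompactRMSpace where
  toRMSpace := (G.trace K hρ).scaled a b ha
  compact := by
    have : Finite ((G.trace K hρ).scaled a b ha).carrier :=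
      (ElectricalNetwork.finite_of_isCompact ha hK).to_subtype
    infer_instance

end RootedNetwork

/-! Points are isolated in the resistance metric, so a compact `K` is finite. The trace onto a
finite set leaves effective resistances unchanged (`resistance_trace`): the harmonic extension of
`φ` has the same energy as `φ` in the trace network, and it minimizes the energy among all
extensions. Hence the identity of `K` is a root-preserving isometry from the restricted space to the
traced space, and only the vertex masses differ. Tracing never increases the total conductance at a
vertex (`cTot_trace_le`) and never decreases a conductance inside `K` (`c_le_traceC`), so the loss
at `x` is at most the conductance from `x` to the complement of `K` (`cTot_le_trace_add`). Summing
over `K` bounds the GHP distance of the two spaces by the crossing conductance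
(`dGHP_restrict_scaledTrace_le`). The deterministic statement is then the triangle inequality for
`dGHP`, and convergence in distribution follows from a Slutsky argument
(`MeasureTheory.TendstoInDistribution.of_edist_le`).

It remains to see that the traced spaces are random elements. A finite network is determined by its
resistance metric, and continuously so among networks with equally many vertices: if resistances
change by at most `η`, the reciprocals of the total conductances change by at most `2 * η`
(`abs_cTot_sub_le`). This comes from writing potentials as charges integrated against the resistance
kernel. Having at least `N` points is an open condition in the GHP topology, so the spaces with
exactly `N` points form a Borel stratum. A map that is continuous on each of countably many Borel
strata is measurable. -/

/-! ### The Lévy-Prokhorov distance under isometries and for discrete measures -/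

/-- Thickening commutes with preimages up to inclusion: a point near `f ⁻¹' B` is mapped near `B`.
So every `ε` that works before the embedding works after it. -/
theorem levyProkhorovEDist_map_le {M N : Type*} [PseudoEMetricSpace M] [PseudoEMetricSpace N]
    [MeasurableSpace M] [BorelSpace M] [MeasurableSpace N] [BorelSpace N] {f : M → N}
    (hf : Isometry f) (μ ν : Measure M) :
    levyProkhorovEDist (μ.map f) (ν.map f) ≤ levyProkhorovEDist μ ν := by
  have hm : Measurable f := hf.continuous.measurable
  refine levyProkhorovEDist_le_of_forall _ _ _ fun ε B hε _ hB => ?_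
  have hB' := hm hB
  have hsub : Metric.thickening ε.toReal (f ⁻¹' B) ⊆ f ⁻¹' Metric.thickening ε.toReal B := by
    intro x hx
    rw [Metric.mem_thickening_iff_exists_edist_lt] at hx
    obtain ⟨z, hz, hxz⟩ := hx
    refine (Metric.mem_thickening_iff_exists_edist_lt _ _).2 ⟨f z, hz, ?_⟩
    rwa [hf.edist_eq]
  have hT : MeasurableSet (Metric.thickening ε.toReal B) := Metric.isOpen_thickening.measurableSet
  rw [Measure.map_apply hm hB, Measure.map_apply hm hB, Measure.map_apply hm hT,
    Measure.map_apply hm hT]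
  refine ⟨(left_measure_le_of_levyProkhorovEDist_lt hε hB').trans ?_,
    (right_measure_le_of_levyProkhorovEDist_lt hε hB').trans ?_⟩ <;>
  · gcongr

/-- Atoms are matched index by index: moving each costs at most `δ` in distance, and adjusting the
weights costs at most `∑ i, η i` in mass. The one-sided estimate `key` is applied twice, with the
roles of the two measures exchanged. -/
theorem levyProkhorovEDist_sum_dirac_le {M ι : Type*} [PseudoEMetricSpace M] [MeasurableSpace M]
    [BorelSpace M] [Fintype ι] (p q : ι → M) (w v η : ι → ℝ≥0∞) {δ : ℝ≥0∞}
    (hpq : ∀ i, edist (p i) (q i) ≤ δ) (hw : ∀ i, w i ≤ v i + η i) (hv : ∀ i, v i ≤ w i + η i)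
    (hη : ∑ i, η i ≤ δ) :
    levyProkhorovEDist (Measure.sum fun i => w i • Measure.dirac (p i))
      (Measure.sum fun i => v i • Measure.dirac (q i)) ≤ δ := by
  have key : ∀ (p q : ι → M) (w v : ι → ℝ≥0∞), (∀ i, edist (p i) (q i) ≤ δ) →
      (∀ i, w i ≤ v i + η i) → ∀ (ε : ℝ≥0∞) (B : Set M), δ < ε → ε < ∞ → MeasurableSet B →
      Measure.sum (fun i => w i • Measure.dirac (p i)) B ≤
        Measure.sum (fun i => v i • Measure.dirac (q i)) (Metric.thickening ε.toReal B) + ε := by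
    intro p q w v hpq hw ε B hε hε' hB
    have hT : MeasurableSet (Metric.thickening ε.toReal B) :=
      Metric.isOpen_thickening.measurableSet
    rw [Measure.sum_apply _ hB, Measure.sum_apply _ hT, tsum_fintype, tsum_fintype]
    refine le_trans ?_ (add_le_add_right (hη.trans hε.le) _)
    rw [← Finset.sum_add_distrib]
    refine Finset.sum_le_sum fun i _ => ?_
    rw [Measure.smul_apply, Measure.smul_apply, Measure.dirac_apply' _ hB,
      Measure.dirac_apply' _ hT, smul_eq_mul, smul_eq_mul]
    by_cases hi : p i ∈ B
    · have : q i ∈ Metric.thickening ε.toReal B := by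
        refine (Metric.mem_thickening_iff_exists_edist_lt _ _).2 ⟨p i, hi, ?_⟩
        rw [ENNReal.ofReal_toReal hε'.ne, edist_comm]
        exact (hpq i).trans_lt hε
      simpa [hi, this] using hw i
    · simp [hi]
  exact levyProkhorovEDist_le_of_forall _ _ _ fun ε B hε hε' hB =>
    ⟨key p q w v hpq hw ε B hε hε' hB,
      key q p v w (fun i => by rw [edist_comm]; exact hpq i) hv ε B hε hε' hB⟩

theorem sum_smul_dirac_map {M N ι : Type*} [MeasurableSpace M] [MeasurableSpace N] {f : M → N}
    (hf : Measurable f) (p : ι → M) (w : ι → ℝ≥0∞) :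
    (Measure.sum fun i => w i • Measure.dirac (p i)).map f =
      Measure.sum fun i => w i • Measure.dirac (f (p i)) := by
  rw [Measure.map_sum hf.aemeasurable]
  simp only [Measure.map_smul, Measure.map_dirac' hf]

/-! ### The Gromov-Hausdorff-Prohorov distance is a pseudometric -/

theorem dGHP_le {X Y : CompactRMSpace} {M : Type} [MetricSpace M] [CompactSpace M]
    [MeasurableSpace M] [BorelSpace M] {f : X.carrier → M} {g : Y.carrier → M} (hf : Isometry f)
    (hg : Isometry g) :
    dGHP X Y ≤ edist (f X.root) (g Y.root) ⊔ Metric.hausdorffEDist (range f) (range g) ⊔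
      levyProkhorovEDist (X.μ.map f) (Y.μ.map g) :=
  iInf_le_of_le M <| iInf_le_of_le ‹_› <| iInf_le_of_le ‹_› <| iInf_le_of_le ‹_› <|
    iInf_le_of_le ‹_› <| iInf_le_of_le f <| iInf_le_of_le g <| iInf_le_of_le hf <|
      iInf_le_of_le hg le_rfl

theorem exists_embedding_of_dGHP_lt {X Y : CompactRMSpace} {r : ℝ≥0∞} (h : dGHP X Y < r) :
    ∃ (M : Type) (_ : MetricSpace M) (_ : CompactSpace M) (_ : MeasurableSpace M)
      (_ : BorelSpace M) (f : X.carrier → M) (g : Y.carrier → M), Isometry f ∧ Isometry g ∧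
      edist (f X.root) (g Y.root) < r ∧ Metric.hausdorffEDist (range f) (range g) < r ∧
      levyProkhorovEDist (X.μ.map f) (Y.μ.map g) < r := by
  simp only [dGHP, iInf_lt_iff, max_lt_iff] at h
  obtain ⟨M, i1, i2, i3, i4, f, g, hf, hg, ⟨h1, h2⟩, h3⟩ := h
  exact ⟨M, i1, i2, i3, i4, f, g, hf, hg, h1, h2, h3⟩

theorem dGHP_self (X : CompactRMSpace) : dGHP X X = 0 := by
  refine le_antisymm ((dGHP_le (f := id) (g := id) isometry_id isometry_id).trans ?_) bot_le
  simp

theorem dGHP_comm_le (X Y : CompactRMSpace) : dGHP X Y ≤ dGHP Y X := by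
  refine le_of_forall_gt fun r hr => ?_
  obtain ⟨M, _, _, _, _, f, g, hf, hg, h1, h2, h3⟩ := exists_embedding_of_dGHP_lt hr
  refine (dGHP_le hg hf).trans_lt ?_
  rw [edist_comm, Metric.hausdorffEDist_comm, levyProkhorovEDist_comm]
  exact max_lt (max_lt h1 h2) h3

theorem dGHP_comm (X Y : CompactRMSpace) : dGHP X Y = dGHP Y X :=
  le_antisymm (dGHP_comm_le X Y) (dGHP_comm_le Y X)

/-- The glued space is covered by the images of two compact spaces. Compactness is needed because
the infimum in `dGHP` runs over compact ambient spaces only. -/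
theorem compactSpace_glueSpace {X Y Z : Type*} [Nonempty Z] [MetricSpace Z] [MetricSpace X]
    [MetricSpace Y] [CompactSpace X] [CompactSpace Y] {Φ : Z → X} {Ψ : Z → Y} (hΦ : Isometry Φ)
    (hΨ : Isometry Ψ) : CompactSpace (Metric.GlueSpace hΦ hΨ) := by
  refine ⟨?_⟩
  have h : (univ : Set (Metric.GlueSpace hΦ hΨ)) =
      range (Metric.toGlueL hΦ hΨ) ∪ range (Metric.toGlueR hΦ hΨ) := by
    refine (eq_univ_of_forall fun z => ?_).symm
    induction z using Quotient.inductionOn' with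
    | h s =>
      rcases s with x | y
      · exact Or.inl ⟨x, rfl⟩
      · exact Or.inr ⟨y, rfl⟩
  rw [h]
  exact (isCompact_range (Metric.toGlueL_isometry hΦ hΨ).continuous).union
    (isCompact_range (Metric.toGlueR_isometry hΦ hΨ).continuous)

/-- Two nearly optimal ambient spaces are glued along their copies of `Y`. Both embeddings of `Y`
become one (`hij`), and root distance, Hausdorff distance and Prohorov distance each satisfy the
triangle inequality through it. -/
theorem dGHP_triangle (X Y Z : CompactRMSpace) : dGHP X Z ≤ dGHP X Y + dGHP Y Z := by
  refine ENNReal.le_of_forall_pos_le_add fun ε hε hfin => ?_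
  have hε2 : ((ε : ℝ≥0∞) / 2) ≠ 0 := by simp [hε.ne']
  have hXY : dGHP X Y ≠ ⊤ := (lt_of_le_of_lt le_self_add hfin).ne
  have hYZ : dGHP Y Z ≠ ⊤ := (lt_of_le_of_lt le_add_self hfin).ne
  have e : dGHP X Y + dGHP Y Z + ε = (dGHP X Y + ε / 2) + (dGHP Y Z + ε / 2) := by
    rw [add_add_add_comm, ENNReal.add_halves]
  rw [e]
  obtain ⟨M, _, _, _, _, f, g, hf, hg, h1, h2, h3⟩ :=
    exists_embedding_of_dGHP_lt (ENNReal.lt_add_right hXY hε2)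
  obtain ⟨N, _, _, _, _, f', g', hf', hg', h1', h2', h3'⟩ :=
    exists_embedding_of_dGHP_lt (ENNReal.lt_add_right hYZ hε2)
  have : Nonempty Y.carrier := ⟨Y.root⟩
  let i := Metric.toGlueL hg hf'
  let j := Metric.toGlueR hg hf'
  have hi : Isometry i := Metric.toGlueL_isometry hg hf'
  have hj : Isometry j := Metric.toGlueR_isometry hg hf'
  have hij : i ∘ g = j ∘ f' := Metric.toGlue_commute hg hf'
  have := compactSpace_glueSpace hg hf'
  let : MeasurableSpace (Metric.GlueSpace hg hf') := borel _
  have : BorelSpace (Metric.GlueSpace hg hf') := ⟨rfl⟩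
  refine (dGHP_le (hi.comp hf) (hj.comp hg')).trans (max_le (max_le ?_ ?_) ?_)
  · refine (edist_triangle _ ((i ∘ g) Y.root) _).trans (add_le_add ?_ ?_)
    · simp only [Function.comp_apply, hi.edist_eq]; exact h1.le
    · rw [hij]; simp only [Function.comp_apply, hj.edist_eq]; exact h1'.le
  · refine (Metric.hausdorffEDist_triangle (t := range (i ∘ g))).trans (add_le_add ?_ ?_)
    · rw [range_comp, range_comp, Metric.hausdorffEDist_image hi]; exact h2.le
    · rw [hij, range_comp, range_comp, Metric.hausdorffEDist_image hj]; exact h2'.le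
  · refine (levyProkhorovEDist_triangle _ (Y.μ.map (i ∘ g)) _).trans (add_le_add ?_ ?_)
    · rw [← Measure.map_map hi.continuous.measurable hf.continuous.measurable,
        ← Measure.map_map hi.continuous.measurable hg.continuous.measurable]
      exact (levyProkhorovEDist_map_le hi _ _).trans h3.le
    · rw [hij, ← Measure.map_map hj.continuous.measurable hf'.continuous.measurable,
        ← Measure.map_map hj.continuous.measurable hg'.continuous.measurable]
      exact (levyProkhorovEDist_map_le hj _ _).trans h3'.le

/-- The pseudometric `dGHP`; it induces the Gromov-Hausdorff-Prohorov topology. -/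
noncomputable instance : PseudoEMetricSpace CompactRMSpace where
  edist := dGHP
  edist_self := dGHP_self
  edist_comm := dGHP_comm
  edist_triangle := dGHP_triangle
  -- The topology is replaced by the one already declared, so that neighbourhoods and Borel sets
  -- here are definitionally those of the GHP instance.
  toUniformSpace := (uniformSpaceOfEDist dGHP dGHP_self dGHP_comm dGHP_triangle).replaceTopology
    (by
      let m : PseudoEMetricSpace CompactRMSpace :=
        { edist := dGHP, edist_self := dGHP_self, edist_comm := dGHP_comm,
          edist_triangle := dGHP_triangle }
      refine TopologicalSpace.ext_iff.2 fun U => ?_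
      refine Iff.trans ?_ (EMetric.isOpen_iff (s := U)).symm
      refine forall₂_congr fun X _ => exists_congr fun ε => and_congr_right fun _ => ?_
      exact ⟨fun h Y hY => h Y (by rw [dGHP_comm]; exact hY),
        fun h Y hY => h (by rw [dGHP_comm] at hY; exact hY)⟩)
  uniformity_edist := rfl

/-- The Gromov-Hausdorff-Prohorov distance of two spaces with isometric underlying rooted spaces
is at most the Lévy-Prokhorov distance of the measures. -/
theorem dGHP_le_of_isometryEquiv {X Y : CompactRMSpace} (e : X.carrier ≃ᵢ Y.carrier)
    (he : e X.root = Y.root) : dGHP X Y ≤ levyProkhorovEDist (X.μ.map e) Y.μ := by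
  refine (dGHP_le e.isometry (isometry_id (α := Y.carrier))).trans ?_
  rw [he, e.surjective.range_eq, Measure.map_id]
  simp

namespace ElectricalNetwork

variable {G : ElectricalNetwork}

/-! ### Bilinear identities for the energy -/

theorem energy_sub_right {f g u : G.V → ℝ} (hf : G.FiniteEnergy f) (hg : G.FiniteEnergy g)
    (hu : G.FiniteEnergy u) : G.energy u (f - g) = G.energy u f - G.energy u g := by
  rw [energy_symm, energy_sub_left hf hg hu, energy_symm f, energy_symm g]

theorem energy_smul_right (r : ℝ) (f u : G.V → ℝ) : G.energy u (r • f) = r * G.energy u f := by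
  rw [energy_symm, energy_smul_left, energy_symm]

theorem finiteEnergy_sum {ι : Type*} (s : Finset ι) {f : ι → G.V → ℝ}
    (hf : ∀ i ∈ s, G.FiniteEnergy (f i)) : G.FiniteEnergy (∑ i ∈ s, f i) := by
  classical
  induction s using Finset.induction_on with
  | empty => rw [Finset.sum_empty]; exact finiteEnergy_const (G := G) 0
  | insert a t ha ih =>
    rw [Finset.sum_insert ha]
    exact (hf a (Finset.mem_insert_self a t)).add
      (ih fun i hi => hf i (Finset.mem_insert_of_mem hi))

theorem energy_sum_left {ι : Type*} (s : Finset ι) {f : ι → G.V → ℝ} {u : G.V → ℝ}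
    (hf : ∀ i ∈ s, G.FiniteEnergy (f i)) (hu : G.FiniteEnergy u) :
    G.energy (∑ i ∈ s, f i) u = ∑ i ∈ s, G.energy (f i) u := by
  classical
  induction s using Finset.induction_on with
  | empty => simp [energy]
  | insert a t ha ih =>
    have hf' : ∀ i ∈ t, G.FiniteEnergy (f i) := fun i hi => hf i (Finset.mem_insert_of_mem hi)
    rw [Finset.sum_insert ha, Finset.sum_insert ha, energy_add_left
      (hf a (Finset.mem_insert_self a t)) (finiteEnergy_sum t hf') hu, ih hf']

theorem energy_sum_right {ι : Type*} (s : Finset ι) {f : ι → G.V → ℝ} {u : G.V → ℝ}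
    (hf : ∀ i ∈ s, G.FiniteEnergy (f i)) (hu : G.FiniteEnergy u) :
    G.energy u (∑ i ∈ s, f i) = ∑ i ∈ s, G.energy u (f i) := by
  rw [energy_symm, energy_sum_left s hf hu]
  exact Finset.sum_congr rfl fun i _ => energy_symm _ _

theorem energy_const_right (r : ℝ) (f : G.V → ℝ) : G.energy f (fun _ => r) = 0 := by
  simp [energy]

/-- Cauchy-Schwarz: the energy of `t • f + g` is a quadratic in `t` without sign change, so its
discriminant is nonpositive. -/
theorem energy_sq_le {f g : G.V → ℝ} (hf : G.FiniteEnergy f) (hg : G.FiniteEnergy g) :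
    G.energy f g ^ 2 ≤ G.energy f f * G.energy g g := by
  have h : ∀ t : ℝ, 0 ≤ G.energy f f * (t * t) + 2 * G.energy f g * t + G.energy g g := by
    intro t
    have h1 := energy_self_nonneg (t • f + g)
    rw [energy_add_self (hf.smul t) hg, energy_smul_left, energy_smul_left,
      energy_smul_right] at h1
    linarith
  have h2 := discrim_le_zero h
  rw [discrim] at h2
  nlinarith

theorem energy_ind_self (x : G.V) : G.energy (ind x) (ind x) = G.cTot x := by
  rw [(energy_ind_eq (finiteEnergy_ind x) x).2, cTot]
  refine tsum_congr fun z => ?_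
  by_cases h : z = x
  · simp [h, c_self]
  · simp [ind_of_ne h]

/-! ### Dipole potentials -/

/-- The potential of a unit current from `x` to `y`. -/
structure IsDipole (x y : G.V) (u : G.V → ℝ) : Prop where
  finiteEnergy : G.FiniteEnergy u
  energy_eq : ∀ v, G.FiniteEnergy v → G.energy u v = v x - v y

/-- The witness is the minimizer `h` with values `1` at `x` and `0` at `y`, divided by its energy.
For any `v`, the function `v - (v x - v y) • h - v y` vanishes at both points and is therefore
orthogonal to `h`. -/
theorem exists_isDipole (x y : G.V) : ∃ u : G.V → ℝ, IsDipole x y u := by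
  by_cases hxy : x = y
  · refine ⟨fun _ => 0, finiteEnergy_const 0, fun v _ => ?_⟩
    rw [energy_symm, energy_const_right, hxy, sub_self]
  obtain ⟨h, hh⟩ := exists_isEnergyMinimizer (B := {x, y}) ⟨x, by simp⟩
    (φ := fun z => ind x (z : G.V)) ⟨ind x, finiteEnergy_ind x, fun _ => rfl⟩
  have hx : h x = 1 := by simpa using hh.eq_on ⟨x, by simp⟩
  have hy : h y = 0 := by simpa [ind_of_ne (Ne.symm hxy)] using hh.eq_on ⟨y, by simp⟩
  have hE : 0 < G.energy h h := by
    have h1 := sq_le_resistance hh.finiteEnergy x y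
    rw [hx, hy] at h1
    by_contra hneg
    nlinarith [resistance_nonneg x y, energy_self_nonneg h]
  refine ⟨(G.energy h h)⁻¹ • h, hh.finiteEnergy.smul _, fun v hv => ?_⟩
  have hF := (hv.sub (hh.finiteEnergy.smul (v x - v y))).sub (finiteEnergy_const (v y))
  have h2 := hh.orthogonal hF (by
    intro z hz
    rcases hz with rfl | rfl <;> simp [hx, hy])
  rw [energy_sub_right (hv.sub (hh.finiteEnergy.smul _)) (finiteEnergy_const _) hh.finiteEnergy,
    energy_sub_right hv (hh.finiteEnergy.smul _) hh.finiteEnergy, energy_const_right,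
    energy_smul_right] at h2
  rw [energy_smul_left]
  field_simp
  linarith

namespace IsDipole

variable {x y z o : G.V} {u w : G.V → ℝ}

/-- The dipole represents the functional `v ↦ v x - v y`, so Cauchy-Schwarz gives one inequality,
and `u` itself as a test function gives the other. -/
theorem resistance_eq (hu : IsDipole x y u) : G.resistance x y = G.energy u u := by
  refine le_antisymm (resistance_le (energy_self_nonneg u) fun f hf => ?_) ?_
  · rw [← hu.energy_eq f hf]
    exact energy_sq_le hu.finiteEnergy hf
  · have h1 := sq_le_resistance hu.finiteEnergy x y
    rw [← hu.energy_eq u hu.finiteEnergy] at h1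
    rcases (energy_self_nonneg u).eq_or_lt with h | h
    · rw [← h]; exact resistance_nonneg x y
    · nlinarith

/-- Polarization: `u - w` is a dipole from `x` to `y`, and the cross term is `energy u w = w x - w
o`. -/
theorem sub_apply (hx : IsDipole x o u) (hy : IsDipole y o w) :
    2 * (w x - w o) = G.resistance x o + G.resistance y o - G.resistance x y := by
  have hd : IsDipole x y (u - w) := ⟨hx.finiteEnergy.sub hy.finiteEnergy, fun v hv => by
    rw [energy_sub_left hx.finiteEnergy hy.finiteEnergy hv, hx.energy_eq v hv, hy.energy_eq v hv]
    ring⟩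
  rw [hx.resistance_eq, hy.resistance_eq, hd.resistance_eq,
    energy_sub_self hx.finiteEnergy hy.finiteEnergy, hx.energy_eq w hy.finiteEnergy]
  ring

end IsDipole

/-! ### Finite networks -/

section Finite

variable [Fintype G.V]

theorem finiteEnergy_of_finite (f : G.V → ℝ) : G.FiniteEnergy f := by
  classical
  exact (hasSum_fintype _).summable

theorem eq_sum_smul_ind (f : G.V → ℝ) : f = ∑ x, f x • ind x := by
  classical
  funext y
  rw [Finset.sum_apply, Finset.sum_eq_single y]
  · simp
  · intro x _ hx
    simp [ind_of_ne hx.symm]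
  · simp

theorem energy_eq_sum (f h : G.V → ℝ) : G.energy f h = ∑ x, G.energy f (ind x) * h x := by
  conv_lhs => rw [eq_sum_smul_ind h]
  rw [energy_sum_right _ (fun _ _ => finiteEnergy_of_finite _) (finiteEnergy_of_finite f)]
  exact Finset.sum_congr rfl fun x _ => by rw [energy_smul_right, mul_comm]

/-- `G.energy f (ind x)` is the charge of `f` at `x`. The total charge is the pairing of `f` with a
constant. -/
theorem sum_energy_ind (f : G.V → ℝ) : ∑ x, G.energy f (ind x) = 0 := by
  have h := energy_eq_sum f (fun _ => 1)
  rw [energy_const_right] at h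
  simpa using h.symm

/-- The potential is recovered from the charges by the resistance kernel. -/
theorem two_mul_sub_eq_sum_resistance (f : G.V → ℝ) (y o : G.V) :
    2 * (f y - f o) =
      ∑ x, G.energy f (ind x) * (G.resistance x o - G.resistance x y) := by
  obtain ⟨w, hw⟩ := exists_isDipole y o
  rw [← hw.energy_eq f (finiteEnergy_of_finite f), energy_symm, energy_eq_sum, Finset.mul_sum]
  have h0 := sum_energy_ind f
  -- The dipole `w` is expressed through resistances. The part of it that does not depend on `x`
  -- disappears in the sum because the charges of `f` sum to zero.
  have h1 : ∀ x, 2 * (G.energy f (ind x) * w x) =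
      G.energy f (ind x) * (G.resistance x o - G.resistance x y) +
        G.energy f (ind x) * (2 * w o + G.resistance y o) := by
    intro x
    obtain ⟨u, hu⟩ := exists_isDipole x o
    have := hu.sub_apply hw
    have h2 : 2 * w x = (G.resistance x o - G.resistance x y) + (2 * w o + G.resistance y o) := by
      linarith
    rw [← mul_add, ← h2]; ring
  rw [Finset.sum_congr rfl fun x _ => h1 x, Finset.sum_add_distrib, ← Finset.sum_mul, h0,
    zero_mul, add_zero]

theorem cTot_eq_sum (x : G.V) : G.cTot x = ∑ y, G.c x y := tsum_fintype _

/-- The indicator of `z` has charge `cTot z` at `z` and `-c z x` at every other `x`. -/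
theorem sum_abs_energy_ind_le (z : G.V) : ∑ x, |G.energy (ind z) (ind x)| ≤ 2 * G.cTot z := by
  classical
  have h1 : ∀ x, x ≠ z → G.energy (ind z) (ind x) = -G.c z x := by
    intro x hx
    rw [(energy_ind_eq (finiteEnergy_ind z) x).2, tsum_fintype, Finset.sum_eq_single z]
    · rw [ind_of_ne hx, ind_self, G.c_symm]; ring
    · intro w _ hw
      rw [ind_of_ne hw, ind_of_ne hx, sub_self, mul_zero]
    · simp
  have hc : 0 ≤ G.cTot z := by
    rw [cTot_eq_sum]
    exact Finset.sum_nonneg fun y _ => G.c_nonneg z y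
  rw [← Finset.add_sum_erase _ _ (Finset.mem_univ z), energy_ind_self, abs_of_nonneg hc, two_mul]
  refine add_le_add le_rfl ?_
  rw [cTot_eq_sum]
  calc ∑ x ∈ Finset.univ.erase z, |G.energy (ind z) (ind x)|
      = ∑ x ∈ Finset.univ.erase z, G.c z x := Finset.sum_congr rfl fun x hx => by
        rw [h1 x (Finset.ne_of_mem_erase hx), abs_neg, abs_of_nonneg (G.c_nonneg z x)]
    _ ≤ ∑ x, G.c z x := Finset.sum_le_sum_of_subset_of_nonneg (Finset.erase_subset _ _)
        fun x _ _ => G.c_nonneg z x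

/-- The potential `f` is, up to a constant, its charges integrated against `-(1 / 2) * R`; the
constant pairs to zero with the neutral `q`. The type `ι` is kept separate so that `q` can be the
charge of another network on the same vertices. -/
theorem energy_eq_neg_half_sum {ι : Type*} [Fintype ι] (σ : G.V ≃ ι) (f : G.V → ℝ) (q : ι → ℝ)
    (hq : ∑ i, q i = 0) :
    ∑ x, q (σ x) * f x =
      -(1 / 2) * ∑ x, ∑ y, G.energy f (ind x) * q (σ y) * G.resistance x y := by
  obtain ⟨o⟩ := G.connected.nonempty
  have hq' : ∑ y, q (σ y) = 0 := by rw [Equiv.sum_comp σ q, hq]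
  have h1 : ∀ y, q (σ y) * f y = q (σ y) * f o +
      q (σ y) * ((1 / 2) * ∑ x, G.energy f (ind x) * G.resistance x o) +
      -(1 / 2) * ∑ x, G.energy f (ind x) * q (σ y) * G.resistance x y := by
    intro y
    have h2 := two_mul_sub_eq_sum_resistance f y o
    simp only [mul_sub, Finset.sum_sub_distrib] at h2
    have h3 : ∑ x, G.energy f (ind x) * q (σ y) * G.resistance x y =
        q (σ y) * ∑ x, G.energy f (ind x) * G.resistance x y := by
      rw [Finset.mul_sum]
      exact Finset.sum_congr rfl fun x _ => by ring
    rw [h3]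
    have h4 : f y = f o + (1 / 2) * ∑ x, G.energy f (ind x) * G.resistance x o -
        (1 / 2) * ∑ x, G.energy f (ind x) * G.resistance x y := by linarith
    rw [h4]; ring
  rw [Finset.sum_congr rfl fun y _ => h1 y, Finset.sum_add_distrib, Finset.sum_add_distrib,
    ← Finset.sum_mul, ← Finset.sum_mul, hq', ← Finset.mul_sum, Finset.sum_comm]
  ring

/-- The reciprocal of the total conductance at a vertex is a Lipschitz function of the resistance
metric of a finite network. -/
theorem abs_cTot_sub_le {H : ElectricalNetwork} [Fintype H.V] (σ : G.V ≃ H.V) {η : ℝ}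
    (hη : ∀ x y, |H.resistance (σ x) (σ y) - G.resistance x y| ≤ η) (z : G.V) :
    |H.cTot (σ z) - G.cTot z| ≤ 2 * η * G.cTot z * H.cTot (σ z) := by
  have hsum : ∀ F : H.V → ℝ, ∑ x, F (σ x) = ∑ y, F y := fun F => Equiv.sum_comp σ F
  have hind : ∀ x, ind (σ z) (σ x) = ind z x := by
    intro x
    by_cases h : x = z
    · simp [h]
    · rw [ind_of_ne h, ind_of_ne (fun h' => h (σ.injective h'))]
  set A : G.V → ℝ := fun x => G.energy (ind z) (ind x) with hA
  set B : G.V → ℝ := fun x => H.energy (ind (σ z)) (ind (σ x)) with hB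
  -- The charge of one network at `z` paired with the indicator of `z` is the total conductance
  -- there. Evaluating the pairing with the kernel of the other network, both ways round, gives the
  -- same double sum over `A` and `B` with two different kernels.
  have e1 : H.cTot (σ z) = -(1 / 2) * ∑ x, ∑ y, A x * B y * G.resistance x y := by
    have h := energy_eq_neg_half_sum σ (ind z) (fun y => H.energy (ind (σ z)) (ind y))
      (sum_energy_ind _)
    rw [← energy_ind_self, energy_eq_sum, ← hsum, ← h]
    exact Finset.sum_congr rfl fun x _ => by rw [hind]
  have e2 : G.cTot z = -(1 / 2) * ∑ x, ∑ y, A x * B y * H.resistance (σ x) (σ y) := by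
    have h := energy_eq_neg_half_sum σ.symm (ind (σ z)) (fun y => G.energy (ind z) (ind y))
      (sum_energy_ind _)
    rw [← hsum] at h
    simp only [← hsum, Equiv.symm_apply_apply, hind] at h
    rw [← energy_ind_self, energy_eq_sum, h, Finset.sum_comm]
    refine congrArg _ (Finset.sum_congr rfl fun x _ => Finset.sum_congr rfl fun y _ => ?_)
    rw [resistance_comm]
    simp only [hA, hB]
    ring
  have e3 : H.cTot (σ z) - G.cTot z =
      (1 / 2) * ∑ x, ∑ y, A x * B y * (H.resistance (σ x) (σ y) - G.resistance x y) := by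
    rw [e1, e2]
    simp only [mul_sub, Finset.sum_sub_distrib]
    ring
  rw [e3, abs_mul, abs_of_pos (by norm_num : (0 : ℝ) < 1 / 2)]
  have hη0 : 0 ≤ η := (abs_nonneg _).trans (hη z z)
  have h1 : |∑ x, ∑ y, A x * B y * (H.resistance (σ x) (σ y) - G.resistance x y)| ≤
      ∑ x, ∑ y, |A x| * |B y| * η := by
    refine (Finset.abs_sum_le_sum_abs _ _).trans (Finset.sum_le_sum fun x _ => ?_)
    refine (Finset.abs_sum_le_sum_abs _ _).trans (Finset.sum_le_sum fun y _ => ?_)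
    rw [abs_mul, abs_mul]
    exact mul_le_mul_of_nonneg_left (hη x y) (by positivity)
  have h2 : ∑ x, ∑ y, |A x| * |B y| * η = (∑ x, |A x|) * (∑ y, |B y|) * η := by
    rw [Finset.sum_mul_sum, Finset.sum_mul]
    exact Finset.sum_congr rfl fun x _ => by rw [Finset.sum_mul]
  have h3 : ∑ x, |A x| ≤ 2 * G.cTot z := sum_abs_energy_ind_le z
  have h4 : ∑ y, |B y| ≤ 2 * H.cTot (σ z) := by
    rw [hsum fun y => |H.energy (ind (σ z)) (ind y)|]
    exact sum_abs_energy_ind_le (σ z)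
  have h5 : (∑ x, |A x|) * (∑ y, |B y|) ≤ (2 * G.cTot z) * (2 * H.cTot (σ z)) :=
    mul_le_mul h3 h4 (Finset.sum_nonneg fun _ _ => abs_nonneg _)
      ((Finset.sum_nonneg fun _ _ => abs_nonneg _).trans h3)
  have h6 := mul_le_mul_of_nonneg_right h5 hη0
  linarith

end Finite

/-! ### Traces onto finite sets -/

theorem cTot_nonneg (x : G.V) : 0 ≤ G.cTot x := tsum_nonneg fun y => G.c_nonneg x y

/-- In the series for the trace conductance, the term `z = y` alone is `c x y`, since `hext B y`
equals `1` at `y`. -/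
theorem c_le_traceC {B : Set G.V} (x y : B) : G.c x y ≤ traceC B x y := by
  by_cases h : x = y
  · rw [h, c_self, traceC_self]
  · obtain ⟨h1, h2⟩ := traceC_eq h
    have h3 := h1.le_tsum (y : G.V) fun z _ => mul_nonneg (G.c_nonneg _ _) (hext_nonneg _ _)
    rwa [hext_apply, ind_self, mul_one, ← h2] at h3

section Trace

variable {B : Set G.V} [Fintype B]

theorem sum_smul_hext_apply (φ : B → ℝ) (x : B) : (∑ y, φ y • hext B y) x = φ x := by
  classical
  rw [Finset.sum_apply, Finset.sum_eq_single x]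
  · simp [hext_apply]
  · intro y _ hy
    rw [Pi.smul_apply, hext_apply, ind_of_ne fun h => hy (Subtype.ext h.symm), smul_zero]
  · simp

/-- Harmonic extension is linear, because orthogonality to functions vanishing on `B` passes to
linear combinations. -/
theorem isEnergyMinimizer_sum_smul_hext (φ : B → ℝ) :
    IsEnergyMinimizer B φ (∑ y, φ y • hext B y) := by
  have hF : ∀ y ∈ Finset.univ, G.FiniteEnergy (φ y • hext B y) :=
    fun y _ => (hext_spec y).finiteEnergy.smul _
  refine IsEnergyMinimizer.of_orthogonal (finiteEnergy_sum _ hF) (sum_smul_hext_apply φ)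
    fun v hv hv0 => ?_
  rw [energy_sum_left _ hF hv]
  exact Finset.sum_eq_zero fun y _ => by
    rw [energy_smul_left, (hext_spec y).orthogonal hv hv0, mul_zero]

theorem sum_hext [Nonempty B] : (∑ y : B, hext B y) = fun _ => 1 := by
  have hB : B.Nonempty := nonempty_coe_sort.1 ‹_›
  have h := isEnergyMinimizer_sum_smul_hext (fun _ : B => (1 : ℝ))
  simp only [one_smul] at h
  refine h.unique hB (IsEnergyMinimizer.of_orthogonal (finiteEnergy_const 1) (fun _ => rfl)
    fun v _ _ => ?_)
  rw [energy_symm, energy_const_right]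

theorem sum_energy_hext (x : B) : ∑ y, G.energy (hext B x) (hext B y) = 0 := by
  have : Nonempty B := ⟨x⟩
  rw [← energy_sum_right _ (fun y _ => (hext_spec y).finiteEnergy) (hext_spec x).finiteEnergy,
    sum_hext, energy_const_right]

/-- The matrix `a` of energies of the functions `hext B x` has zero row sums, so its quadratic form
is a sum of squared differences with weights `-a x y`. Off the diagonal these weights are the trace
conductances; the diagonal contributes nothing. -/
theorem energy_trace_self (hB : B.Nonempty) (φ : B → ℝ) :
    (G.trace B hB).energy φ φ =
      G.energy (∑ y, φ y • hext B y) (∑ y, φ y • hext B y) := by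
  classical
  set a : B → B → ℝ := fun x y => G.energy (hext B x) (hext B y) with ha
  have hF : ∀ y ∈ Finset.univ, G.FiniteEnergy (φ y • hext B y) :=
    fun y _ => (hext_spec y).finiteEnergy.smul _
  have h1 : G.energy (∑ y, φ y • hext B y) (∑ y, φ y • hext B y) =
      ∑ x, ∑ y, a x y * (φ x * φ y) := by
    rw [energy_sum_left _ hF (finiteEnergy_sum _ hF)]
    refine Finset.sum_congr rfl fun x hx => ?_
    rw [energy_sum_right _ hF (hF x hx)]
    refine Finset.sum_congr rfl fun y _ => ?_
    rw [energy_smul_left, energy_smul_right]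
    ring
  have h2 : (G.trace B hB).energy φ φ =
      (1 / 2) * ∑ x, ∑ y, -a x y * (φ x - φ y) ^ 2 := by
    refine (energy_self (G := G.trace B hB) φ).trans (congrArg _ ?_)
    change ∑' p : B × B, traceC B p.1 p.2 * (φ p.1 - φ p.2) ^ 2 = _
    rw [tsum_fintype, Fintype.sum_prod_type]
    refine Finset.sum_congr rfl fun x _ => Finset.sum_congr rfl fun y _ => ?_
    by_cases h : x = y
    · simp [h]
    · rw [traceC, if_neg h]
      rfl
  have h3 : ∑ x, ∑ y, a x y * (φ x) ^ 2 = 0 := Finset.sum_eq_zero fun x _ => by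
    rw [← Finset.sum_mul, sum_energy_hext, zero_mul]
  have h4 : ∑ x, ∑ y, a x y * (φ y) ^ 2 = 0 := by
    rw [Finset.sum_comm, ← h3]
    exact Finset.sum_congr rfl fun x _ => Finset.sum_congr rfl fun y _ => by
      rw [ha]; simp only [energy_symm]
  have h5 : ∀ x y, -a x y * (φ x - φ y) ^ 2 =
      2 * (a x y * (φ x * φ y)) - a x y * (φ x) ^ 2 - a x y * (φ y) ^ 2 := fun x y => by ring
  rw [h1, h2]
  simp only [h5, Finset.sum_sub_distrib, h3, h4, ← Finset.mul_sum]
  ring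

/-- Extending `φ` harmonically preserves its energy, and restricting `f` to `B` does not increase
the energy; both preserve the difference of values at `x` and `y`. -/
theorem resistance_trace (hB : B.Nonempty) (x y : B) :
    (G.trace B hB).resistance x y = G.resistance (x : G.V) y := by
  have : Fintype (G.trace B hB).V := ‹Fintype B›
  have key : ∀ φ : B → ℝ,
      (φ x - φ y) ^ 2 ≤ G.resistance (x : G.V) y * (G.trace B hB).energy φ φ := by
    intro φ
    have h := sq_le_resistance
      (isEnergyMinimizer_sum_smul_hext (G := G) (B := B) φ).finiteEnergy x y
    rwa [sum_smul_hext_apply, sum_smul_hext_apply, ← energy_trace_self hB] at h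
  refine le_antisymm (resistance_le (resistance_nonneg _ _) fun φ _ => key φ)
    (resistance_le (resistance_nonneg _ _) fun f hf => ?_)
  · let φ : B → ℝ := fun z => f z
    have h := sq_le_resistance (G := G.trace B hB) (finiteEnergy_of_finite φ) x y
    refine h.trans (mul_le_mul_of_nonneg_left ?_ (resistance_nonneg _ _))
    rw [energy_trace_self hB]
    exact (isEnergyMinimizer_sum_smul_hext φ).energy_le f hf fun _ => rfl

/-- Exchanging the sums weights each `c x z` by the sum of `hext B y z` over `y ≠ x`, which is at
most `1`. -/
theorem cTot_trace_le (hB : B.Nonempty) (x : B) :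
    (G.trace B hB).cTot x ≤ G.cTot (x : G.V) := by
  classical
  change ∑' y, traceC B x y ≤ _
  rw [tsum_fintype, ← Finset.sum_erase Finset.univ (traceC_self B x)]
  have h1 : ∀ y ∈ Finset.univ.erase x, Summable (fun z => G.c x z * hext B y z) :=
    fun y hy => (traceC_eq (Finset.ne_of_mem_erase hy).symm).1
  rw [Finset.sum_congr rfl fun y hy => (traceC_eq (Finset.ne_of_mem_erase hy).symm).2,
    ← Summable.tsum_finsetSum h1]
  refine Summable.tsum_le_tsum (fun z => ?_) (summable_sum h1) (G.summable_c x)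
  rw [← Finset.mul_sum]
  exact mul_le_of_le_one_right (G.c_nonneg _ _) (sum_hext_le_one ⟨x, x.2⟩ _ z)

theorem cTot_le_trace_add (hB : B.Nonempty) (x : B) :
    G.cTot (x : G.V) ≤ (G.trace B hB).cTot x + ∑' y : (Bᶜ : Set G.V), G.c x y := by
  have hs := G.summable_c x
  rw [cTot, ← hs.tsum_subtype_add_tsum_subtype_compl B]
  refine add_le_add ?_ le_rfl
  change _ ≤ ∑' y, traceC B x y
  rw [tsum_fintype, tsum_fintype]
  exact Finset.sum_le_sum fun y _ => c_le_traceC x y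

end Trace

end ElectricalNetwork

/-! ### Measures of scaled networks -/

theorem RMSpace.restrict_μ_eq {X : RMSpace} {w : X.carrier → ℝ≥0∞}
    (hX : X.μ = Measure.sum fun x => w x • Measure.dirac x) {K : Set X.carrier} (hK : IsCompact K)
    (hρ : X.root ∈ K) :
    (X.restrict K hK hρ).μ =
      Measure.sum fun x : (X.restrict K hK hρ).carrier => w x.1 • Measure.dirac x := by
  have hemb : MeasurableEmbedding (Subtype.val : K → X.carrier) :=
    MeasurableEmbedding.subtype_coe hK.isClosed.measurableSet
  change X.μ.comap (Subtype.val : K → X.carrier) = Measure.sum fun x : K => w x • Measure.dirac x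
  refine Measure.ext fun s hs => ?_
  have hs' := hemb.measurableSet_image.2 hs
  rw [hemb.comap_apply, hX, Measure.sum_apply _ hs', Measure.sum_apply _ hs]
  simp only [Measure.smul_apply, Measure.dirac_apply' _ hs, Measure.dirac_apply' _ hs',
    smul_eq_mul]
  have h := tsum_subtype K fun x => w x * (Subtype.val '' s).indicator 1 x
  have hsupp : K.indicator (fun x => w x * (Subtype.val '' s).indicator 1 x) =
      fun x => w x * (Subtype.val '' s).indicator 1 x := by
    refine indicator_eq_self.2 fun x hx => ?_
    by_contra hxK
    exact hx (by simp [hxK])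
  rw [hsupp] at h
  rw [← h]
  refine tsum_congr fun x => ?_
  by_cases hx : x ∈ s <;> simp [hx]

namespace RootedNetwork

/-- The mass of a vertex in the scaled space of a network. -/
noncomputable def scaledMass (G : ElectricalNetwork) (b : ℝ) (x : G.V) : ℝ≥0∞ :=
  ENNReal.ofReal b⁻¹ * ENNReal.ofReal (G.cTot x)

theorem scaled_μ_eq (G : RootedNetwork) (a b : ℝ) (ha : 0 < a) :
    (G.scaled a b ha).μ = Measure.sum fun x : (G.scaled a b ha).carrier =>
      scaledMass G.toElectricalNetwork b x • Measure.dirac x := by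
  refine Measure.ext fun s hs => ?_
  change (ENNReal.ofReal b⁻¹ • Measure.sum fun x : (G.scaled a b ha).carrier =>
    ENNReal.ofReal (G.cTot x) • Measure.dirac x : Measure (G.scaled a b ha).carrier) s = _
  rw [Measure.smul_apply, Measure.sum_apply _ hs, Measure.sum_apply _ hs, smul_eq_mul,
    ← ENNReal.tsum_mul_left]
  refine tsum_congr fun x => ?_
  rw [Measure.smul_apply, Measure.smul_apply, smul_eq_mul, smul_eq_mul, ← mul_assoc]
  rfl

theorem restrict_scaled_μ_eq (G : RootedNetwork) (a b : ℝ) (ha : 0 < a) (K : Set G.V)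
    (hK : IsCompact (X := (G.scaled a b ha).carrier) K) (hρ : G.root ∈ K) :
    ((G.scaled a b ha).restrict K hK hρ).μ =
      Measure.sum fun x : ((G.scaled a b ha).restrict K hK hρ).carrier =>
        scaledMass G.toElectricalNetwork b x.1 • Measure.dirac x :=
  RMSpace.restrict_μ_eq (scaled_μ_eq G a b ha) hK hρ

/-! ### Comparison of the restricted space with the trace -/

/-- The restriction of a scaled network to a finite set is isometric to the scaled trace. -/
noncomputable def restrictIsometryTrace (G : RootedNetwork) (a b : ℝ) (ha : 0 < a) (K : Set G.V)
    (hK : IsCompact (X := (G.scaled a b ha).carrier) K) (hρ : G.root ∈ K) :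
    ((G.scaled a b ha).restrict K hK hρ).carrier ≃ᵢ (G.scaledTrace a b ha K hK hρ).carrier where
  toEquiv := Equiv.refl K
  isometry_toFun := Isometry.of_dist_eq fun x y => by
    have : Fintype K := (ElectricalNetwork.finite_of_isCompact ha hK).fintype
    exact congrArg (a⁻¹ * ·) (ElectricalNetwork.resistance_trace ⟨G.root, hρ⟩ x y)

/-- The spaces are isometric by the identity, so only the Prohorov distance counts. Atoms sit at the
same points, and the mass lost at `x` is at most the scaled conductance from `x` to the complement
of `K`. -/
theorem dGHP_restrict_scaledTrace_le (G : RootedNetwork) {a b : ℝ} (ha : 0 < a) (hb : 0 < b)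
    (K : Set G.V) (hK : IsCompact (X := (G.scaled a b ha).carrier) K) (hρ : G.root ∈ K) :
    dGHP ((G.scaled a b ha).restrict K hK hρ) (G.scaledTrace a b ha K hK hρ) ≤
      G.crossing b K := by
  have : Fintype K := (ElectricalNetwork.finite_of_isCompact ha hK).fintype
  have hb' := inv_pos.2 hb
  set e := restrictIsometryTrace G a b ha K hK hρ with he
  refine (dGHP_le_of_isometryEquiv e rfl).trans ?_
  have hμ : (G.scaledTrace a b ha K hK hρ).μ =
      Measure.sum fun x : K => scaledMass (G.trace K hρ).toElectricalNetwork b x •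
        @Measure.dirac (G.scaledTrace a b ha K hK hρ).carrier _ x :=
    scaled_μ_eq (G.trace K hρ) a b ha
  rw [restrict_scaled_μ_eq, sum_smul_dirac_map e.continuous.measurable, hμ]
  have hB : K.Nonempty := ⟨G.root, hρ⟩
  have hsum : ∀ x : K, Summable fun y : (Kᶜ : Set G.V) => G.c x y :=
    fun x => (G.summable_c x).subtype _
  have hη : ∀ x : K, ∑' y : (Kᶜ : Set G.V), ENNReal.ofReal (b⁻¹ * G.c x y) =
      ENNReal.ofReal b⁻¹ * ENNReal.ofReal (∑' y : (Kᶜ : Set G.V), G.c x y) := by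
    intro x
    rw [ENNReal.ofReal_tsum_of_nonneg (fun y => G.c_nonneg _ _) (hsum x), ← ENNReal.tsum_mul_left]
    exact tsum_congr fun y => ENNReal.ofReal_mul hb'.le
  refine levyProkhorovEDist_sum_dirac_le (ι := K) _ _ _ _
    (fun x => ∑' y : (Kᶜ : Set G.V), ENNReal.ofReal (b⁻¹ * G.c x y)) (fun x => ?_) (fun x => ?_)
    (fun x => ?_) ?_
  · refine le_of_eq_of_le ?_ bot_le
    exact edist_self (α := (G.scaledTrace a b ha K hK hρ).carrier) x
  · simp only [hη, scaledMass]
    rw [← mul_add]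
    refine mul_le_mul_right ?_ _
    exact (ENNReal.ofReal_le_ofReal (ElectricalNetwork.cTot_le_trace_add hB x)).trans
      ENNReal.ofReal_add_le
  · refine le_add_right ?_
    refine mul_le_mul_right ?_ _
    exact ENNReal.ofReal_le_ofReal (ElectricalNetwork.cTot_trace_le hB x)
  · rw [ElectricalNetwork.crossing, tsum_fintype]

/-! ### Finite networks depend continuously on their resistance metric -/

/-- The scaled space of a finite network. -/
noncomputable def finiteScaled (H : RootedNetwork) (a b : ℝ) (ha : 0 < a) [Finite H.V] :
    CompactRMSpace where
  toRMSpace := H.scaled a b ha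
  compact := by
    have : Finite (H.scaled a b ha).carrier := ‹Finite H.V›
    infer_instance

/-- Metric closeness alone forces the network measures to be close. For this reason the hypothesis
concerns spaces `X`, `X'` that are isometric to the networks but may carry other measures, as
restricted spaces do relative to traces. -/
theorem exists_forall_dGHP_finiteScaled_lt (H : RootedNetwork) [Finite H.V] {a b : ℝ} (ha : 0 < a)
    (hb : 0 < b) {ε : ℝ≥0∞} (hε : 0 < ε) :
    ∃ δ > 0, ∀ (H' : RootedNetwork) (_ : Finite H'.V) (X X' : CompactRMSpace)
      (e : X.carrier ≃ᵢ (H.finiteScaled a b ha).carrier)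
      (e' : X'.carrier ≃ᵢ (H'.finiteScaled a b ha).carrier),
      e X.root = H.root → e' X'.root = H'.root → Nat.card H'.V = Nat.card H.V → dGHP X X' < δ →
        dGHP (H.finiteScaled a b ha) (H'.finiteScaled a b ha) < ε := by
  have : Fintype H.V := Fintype.ofFinite _
  have hb' := inv_pos.2 hb
  have ha' := inv_pos.2 ha
  obtain ⟨r, hr, hrε⟩ : ∃ r : ℝ, 0 < r ∧ ENNReal.ofReal r < ε := by
    obtain ⟨r, -, h0, h1⟩ := ENNReal.lt_iff_exists_real_btwn.1 hε
    exact ⟨r, ENNReal.ofReal_pos.1 h0, h1⟩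
  set C : ℝ := ∑ x, H.cTot x with hC
  have hCx : ∀ x, H.cTot x ≤ C := fun x =>
    Finset.single_le_sum (fun y _ => ElectricalNetwork.cTot_nonneg y) (Finset.mem_univ x)
  have hC0 : 0 ≤ C := Finset.sum_nonneg fun y _ => ElectricalNetwork.cTot_nonneg y
  have hsmall : ∀ k s : ℝ, 0 < s → ∀ᶠ δ in 𝓝[>] (0 : ℝ), k * δ < s := by
    intro k s hs
    have h : Tendsto (fun δ : ℝ => k * δ) (𝓝[>] 0) (𝓝 (k * 0)) :=
      (tendsto_const_nhds.mul tendsto_id).mono_left nhdsWithin_le_nhds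
    rw [mul_zero] at h
    exact (tendsto_order.1 h).2 s hs
  have hsep : ∀ᶠ δ in 𝓝[>] (0 : ℝ), ∀ x y : H.V, x ≠ y → 2 * δ < a⁻¹ * H.resistance x y := by
    refine Filter.eventually_all.2 fun x => Filter.eventually_all.2 fun y => ?_
    by_cases hxy : x = y
    · exact Filter.Eventually.of_forall fun δ h => absurd hxy h
    · exact (hsmall 2 _ (mul_pos ha' (ElectricalNetwork.resistance_pos hxy))).mono fun δ h _ => h
  -- In order: `δ` is small enough for matched points to stay distinct, for the a priori bound `h7`
  -- on the new conductances, for the total change of mass to be below `r`, and for the root and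
  -- Hausdorff distances.
  obtain ⟨δ, hδ1, hδ2, hδ3, hδr, hδ0⟩ := (hsep.and <| (hsmall (8 * a * C) 1 one_pos).and <|
    (hsmall (Fintype.card H.V * (b⁻¹ * (8 * a * C ^ 2))) r hr).and <| (hsmall 1 r hr).and
    self_mem_nhdsWithin).exists
  simp only [one_mul] at hδr
  replace hδ0 : 0 < δ := hδ0
  refine ⟨ENNReal.ofReal δ, ENNReal.ofReal_pos.2 hδ0, fun H' _ X X' e e' he he' hcard hXX' => ?_⟩
  have : Fintype H'.V := Fintype.ofFinite _
  obtain ⟨M, _, _, _, _, f, g, hf, hg, h1, h2, -⟩ := exists_embedding_of_dGHP_lt hXX'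
  let p : (H.finiteScaled a b ha).carrier → M := f ∘ e.symm
  let q : (H'.finiteScaled a b ha).carrier → M := g ∘ e'.symm
  have hp : Isometry p := hf.comp e.symm.isometry
  have hq : Isometry q := hg.comp e'.symm.isometry
  have hpr : range p = range f := e.symm.surjective.range_comp f
  have hqr : range q = range g := e'.symm.surjective.range_comp g
  have hpd : ∀ x y : H.V, dist (p x) (p y) = a⁻¹ * H.resistance x y := fun x y => hp.dist_eq x y
  have hqd : ∀ x y : H'.V, dist (q x) (q y) = a⁻¹ * H'.resistance x y := fun x y => hq.dist_eq x y
  have hex : ∀ x : H.V, ∃ y : H'.V, dist (p x) (q y) < δ := by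
    intro x
    rw [← hpr, ← hqr] at h2
    obtain ⟨z, ⟨y, rfl⟩, hy⟩ := Metric.exists_edist_lt_of_hausdorffEDist_lt (mem_range_self x) h2
    exact ⟨y, edist_lt_ofReal.1 hy⟩
  choose s hs using hex
  have hinj : Function.Injective s := by
    intro x y hxy
    by_contra hne
    have h3 := hδ1 x y hne
    rw [← hpd] at h3
    have h4 := dist_triangle_right (p x) (p y) (q (s x))
    have h5 := hs y
    rw [← hxy] at h5
    linarith [hs x]
  -- Choosing a close point is injective by separation, hence bijective since the two networks have
  -- equally many vertices.
  let σ : H.V ≃ H'.V := Equiv.ofBijective s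
    (hinj.bijective_of_nat_card_le hcard.le)
  have hσ : ∀ x, dist (p x) (q (σ x)) < δ := hs
  have hres : ∀ x y, |H'.resistance (σ x) (σ y) - H.resistance x y| ≤ a * (2 * δ) := by
    intro x y
    have h3 := dist_dist_dist_le (q (σ x)) (q (σ y)) (p x) (p y)
    rw [Real.dist_eq, hpd, hqd, ← mul_sub, abs_mul, abs_of_pos ha', inv_mul_le_iff₀ ha,
      dist_comm, dist_comm (q (σ y))] at h3
    refine h3.trans (mul_le_mul_of_nonneg_left ?_ ha.le)
    linarith [hσ x, hσ y]
  have hcdiff : ∀ x, |H'.cTot (σ x) - H.cTot x| ≤ 8 * a * C ^ 2 * δ := by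
    intro x
    have h3 := ElectricalNetwork.abs_cTot_sub_le σ hres x
    have h4 : 0 ≤ H'.cTot (σ x) := ElectricalNetwork.cTot_nonneg _
    have h5 : 0 ≤ H.cTot x := ElectricalNetwork.cTot_nonneg _
    have h6 : 2 * (a * (2 * δ)) * H.cTot x * H'.cTot (σ x) ≤
        (4 * a * C * δ) * H'.cTot (σ x) := by
      refine mul_le_mul_of_nonneg_right ?_ h4
      have := mul_le_mul_of_nonneg_left (hCx x) (by positivity : 0 ≤ 4 * a * δ)
      linarith
    -- The Lipschitz bound involves the unknown `H'.cTot (σ x)`; its coefficient is below `1 / 2`,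
    -- so it is absorbed into the left side.
    have h7 : H'.cTot (σ x) ≤ 2 * C := by
      have h8 := (abs_le.1 (h3.trans h6)).2
      have h9 : (4 * a * C * δ) * H'.cTot (σ x) ≤ 1 / 2 * H'.cTot (σ x) :=
        mul_le_mul_of_nonneg_right (by linarith) h4
      linarith [hCx x]
    refine (h3.trans h6).trans ?_
    have := mul_le_mul_of_nonneg_left h7 (by positivity : 0 ≤ 4 * a * C * δ)
    linarith
  refine (dGHP_le hp hq).trans_lt (max_lt (max_lt ?_ ?_) ?_)
  · have hpρ : p (H.finiteScaled a b ha).root = f X.root :=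
      congrArg f ((e.symm_apply_eq).2 he.symm)
    have hqρ : q (H'.finiteScaled a b ha).root = g X'.root :=
      congrArg g ((e'.symm_apply_eq).2 he'.symm)
    rw [hpρ, hqρ]
    exact h1.trans_le ((ENNReal.ofReal_le_ofReal hδr.le).trans hrε.le)
  · rw [hpr, hqr]
    exact h2.trans_le ((ENNReal.ofReal_le_ofReal hδr.le).trans hrε.le)
  refine lt_of_le_of_lt ?_ hrε
  have hμ : (H.finiteScaled a b ha).μ.map p =
      Measure.sum fun x : H.V => scaledMass H.toElectricalNetwork b x • Measure.dirac (p x) :=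
    (congrArg (Measure.map p) (scaled_μ_eq H a b ha)).trans
      (sum_smul_dirac_map hp.continuous.measurable _ _)
  have hμ' : (H'.finiteScaled a b ha).μ.map q = Measure.sum fun x : H.V =>
      scaledMass H'.toElectricalNetwork b (σ x) • Measure.dirac (q (σ x)) := by
    have h3 : (H'.finiteScaled a b ha).μ.map q = Measure.sum fun x : H'.V =>
        scaledMass H'.toElectricalNetwork b x • Measure.dirac (q x) :=
      (congrArg (Measure.map q) (scaled_μ_eq H' a b ha)).trans
        (sum_smul_dirac_map hq.continuous.measurable _ _)
    rw [h3]
    refine Measure.ext fun B hB => ?_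
    rw [Measure.sum_apply _ hB, Measure.sum_apply _ hB]
    exact (σ.tsum_eq fun y =>
      (scaledMass H'.toElectricalNetwork b y • Measure.dirac (q y) : Measure M) B).symm
  rw [hμ, hμ']
  have hmass : ∀ u v : ℝ, |u - v| ≤ 8 * a * C ^ 2 * δ →
      ENNReal.ofReal b⁻¹ * ENNReal.ofReal u ≤ ENNReal.ofReal b⁻¹ * ENNReal.ofReal v +
        ENNReal.ofReal (b⁻¹ * (8 * a * C ^ 2 * δ)) := by
    intro u v huv
    rw [ENNReal.ofReal_mul hb'.le, ← mul_add]
    refine mul_le_mul_right ?_ _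
    refine (ENNReal.ofReal_le_ofReal ?_).trans ENNReal.ofReal_add_le
    linarith [(abs_le.1 huv).2]
  refine levyProkhorovEDist_sum_dirac_le _ _ _ _
    (fun _ => ENNReal.ofReal (b⁻¹ * (8 * a * C ^ 2 * δ))) (fun x => ?_)
    (fun x => hmass _ _ ?_) (fun x => hmass _ _ (hcdiff x)) ?_
  · rw [edist_dist]
    exact ENNReal.ofReal_le_ofReal ((hσ x).le.trans hδr.le)
  · rw [abs_sub_comm]; exact hcdiff x
  · rw [Finset.sum_const, Finset.card_univ, nsmul_eq_mul, ← ENNReal.ofReal_natCast,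
      ← ENNReal.ofReal_mul (Nat.cast_nonneg _)]
    refine ENNReal.ofReal_le_ofReal ?_
    linarith

end RootedNetwork

/-! ### Measurability of maps that are continuous on strata -/

/-- On each stratum the preimage of an open set under `Y` is cut out by a condition `X ω ∈ W N`,
where `W N` is the union of all admissible open sets. This union is open however many sets it
involves; only the strata need to be countable. -/
theorem measurable_of_continuous_on_strata {Ω E F : Type*} [MeasurableSpace Ω] [TopologicalSpace E]
    [MeasurableSpace E] [OpensMeasurableSpace E] [TopologicalSpace F] [MeasurableSpace F]
    [BorelSpace F] {X : Ω → E} {Y : Ω → F} (hX : Measurable X) {S : ℕ → Set E}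
    (hS : ∀ N, MeasurableSet (S N)) (hcover : ∀ ω, ∃ N, X ω ∈ S N)
    (h : ∀ N ω, X ω ∈ S N → ∀ U ∈ 𝓝 (Y ω), ∃ V ∈ 𝓝 (X ω), ∀ ω', X ω' ∈ S N → X ω' ∈ V → Y ω' ∈ U) :
    Measurable Y := by
  refine measurable_of_isOpen fun U hU => ?_
  let W : ℕ → Set E := fun N =>
    ⋃₀ {V | IsOpen V ∧ ∀ ω, X ω ∈ S N → X ω ∈ V → Y ω ∈ U}
  have hW : ∀ N, IsOpen (W N) := fun N => isOpen_sUnion fun V hV => hV.1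
  have heq : Y ⁻¹' U = ⋃ N, X ⁻¹' (S N ∩ W N) := by
    ext ω
    simp only [mem_preimage, mem_iUnion, mem_inter_iff]
    constructor
    · intro hω
      obtain ⟨N, hN⟩ := hcover ω
      obtain ⟨V, hV, hVU⟩ := h N ω hN U (hU.mem_nhds hω)
      obtain ⟨V', hV', hopen, hmem⟩ := mem_nhds_iff.1 hV
      exact ⟨N, hN, V', ⟨hopen, fun ω' h1 h2 => hVU ω' h1 (hV' h2)⟩, hmem⟩
    · rintro ⟨N, hN, V, hV, hmem⟩
      exact hV.2 ω hN hmem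
  rw [heq]
  exact MeasurableSet.iUnion fun N => hX ((hS N).inter (hW N).measurableSet)

theorem aemeasurable_of_continuous_on_strata {Ω E F : Type*} [MeasurableSpace Ω]
    [TopologicalSpace E] [MeasurableSpace E] [OpensMeasurableSpace E] [TopologicalSpace F]
    [MeasurableSpace F] [BorelSpace F] {μ : Measure Ω} {X : Ω → E} {Y : Ω → F}
    (hX : AEMeasurable X μ) {S : ℕ → Set E}
    (hS : ∀ N, MeasurableSet (S N)) (hcover : ∀ ω, ∃ N, X ω ∈ S N)
    (h : ∀ N ω, X ω ∈ S N → ∀ U ∈ 𝓝 (Y ω), ∃ V ∈ 𝓝 (X ω), ∀ ω', X ω' ∈ S N → X ω' ∈ V → Y ω' ∈ U) :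
    AEMeasurable Y μ := by
  classical
  rcases isEmpty_or_nonempty Ω with hΩ | ⟨⟨ω₀⟩⟩
  · exact (measurable_of_empty Y).aemeasurable
  obtain ⟨X', hX', hXX'⟩ := hX
  set A := toMeasurable μ {ω | X ω ≠ X' ω} with hA
  have hAm : MeasurableSet A := measurableSet_toMeasurable _ _
  have hA0 : μ A = 0 := by rw [hA, measure_toMeasurable]; exact hXX'
  -- The sample point is redirected on the null set, instead of replacing `X` by `X'`: the
  -- hypotheses on strata concern actual pairs `(X ω, Y ω)` only, and `X'` may take other values.
  let τ : Ω → Ω := fun ω => if ω ∈ A then ω₀ else ω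
  have hXτ : Measurable (X ∘ τ) := by
    have : X ∘ τ = A.piecewise (fun _ => X ω₀) X' := by
      funext ω
      by_cases hω : ω ∈ A
      · simp [τ, hω]
      · have h1 : X ω = X' ω := by
          by_contra hne
          exact hω (subset_toMeasurable _ _ hne)
        simp [τ, hω, h1]
    rw [this]
    exact measurable_const.piecewise hAm hX'
  refine ⟨Y ∘ τ, measurable_of_continuous_on_strata hXτ hS (fun ω => hcover (τ ω))
    (fun N ω hω U hU => ?_), ?_⟩
  · obtain ⟨V, hV, hVU⟩ := h N (τ ω) hω U hU
    exact ⟨V, hV, fun ω' => hVU (τ ω')⟩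
  · filter_upwards [measure_eq_zero_iff_ae_notMem.1 hA0] with ω hω
    simp [τ, hω]

/-! ### Slutsky's theorem in a pseudoemetric space -/

/-- Bounded Lipschitz functions test weak convergence. For such `f`, the integrals along `X n` and
`Y n` differ by at most `L * r` where `d n` is below `r`, plus the oscillation of `f` times the
probability of the rest. -/
theorem MeasureTheory.TendstoInDistribution.of_edist_le {E : Type*} [PseudoEMetricSpace E]
    [MeasurableSpace E] [OpensMeasurableSpace E] {Ω : ℕ → Type*} [∀ n, MeasurableSpace (Ω n)]
    {P : (n : ℕ) → Measure (Ω n)} [∀ n, IsProbabilityMeasure (P n)] {Ω' : Type*}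
    [MeasurableSpace Ω'] {P' : Measure Ω'} [IsProbabilityMeasure P'] {X Y : (n : ℕ) → Ω n → E}
    {Z : Ω' → E} (hX : TendstoInDistribution X atTop Z P P') (hY : ∀ n, AEMeasurable (Y n) (P n))
    {d : (n : ℕ) → Ω n → ℝ≥0∞} (hXY : ∀ n ω, edist (X n ω) (Y n ω) ≤ d n ω)
    (hd : ∀ ε : ℝ≥0∞, 0 < ε → Tendsto (fun n => P n {ω | ε ≤ d n ω}) atTop (𝓝 0)) :
    TendstoInDistribution Y atTop Z P P' := by
  refine ⟨hY, hX.aemeasurable_limit, ?_⟩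
  refine tendsto_iff_forall_lipschitz_integral_tendsto.2 fun f hfb hfL => ?_
  have hlim := tendsto_iff_forall_lipschitz_integral_tendsto.1 hX.tendsto f hfb hfL
  obtain ⟨C, hC⟩ := hfb
  obtain ⟨L, hL⟩ := hfL
  have hfm : ∀ μ : Measure E, AEStronglyMeasurable f μ :=
    fun μ => hL.continuous.aestronglyMeasurable
  have hint : ∀ μ : Measure E, IsFiniteMeasure μ → Integrable f μ := by
    intro μ _
    rcases isEmpty_or_nonempty E with hE | ⟨⟨x₀⟩⟩
    · have : μ = 0 := Measure.eq_zero_of_isEmpty μ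
      rw [this]; exact integrable_zero_measure
    · refine Integrable.of_bound (hfm μ) (C + ‖f x₀‖) (Filter.Eventually.of_forall fun x => ?_)
      have h1 := hC x x₀
      rw [dist_eq_norm] at h1
      linarith [norm_le_norm_sub_add (f x) (f x₀)]
  have hXm := hX.forall_aemeasurable
  have hIX : ∀ n, Integrable (fun ω => f (X n ω)) (P n) := fun n =>
    (integrable_map_measure (hfm _) (hXm n)).1 (hint _ inferInstance)
  have hIY : ∀ n, Integrable (fun ω => f (Y n ω)) (P n) := fun n =>
    (integrable_map_measure (hfm _) (hY n)).1 (hint _ inferInstance)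
  have hbound : ∀ (r : ℝ), 0 < r → ∀ n,
      dist (∫ ω, f (Y n ω) ∂P n) (∫ ω, f (X n ω) ∂P n) ≤
        L * r + |C| * (P n).real {ω | ENNReal.ofReal r ≤ d n ω} := by
    intro r hr n
    -- Since `d n` need not be measurable, the exceptional set is replaced by a measurable hull of
    -- the same measure.
    set A := toMeasurable (P n) {ω | ENNReal.ofReal r ≤ d n ω} with hA
    have hAm : MeasurableSet A := measurableSet_toMeasurable _ _
    rw [dist_eq_norm, ← integral_sub (hIY n) (hIX n)]
    have hg : Integrable (fun ω => L * r + A.indicator (fun _ => |C|) ω) (P n) :=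
      (integrable_const _).add ((integrable_const _).indicator hAm)
    refine (norm_integral_le_of_norm_le hg (Filter.Eventually.of_forall fun ω => ?_)).trans ?_
    · have hLr : 0 ≤ L * r := by positivity
      rw [← dist_eq_norm]
      by_cases hω : ω ∈ A
      · rw [indicator_of_mem hω]
        linarith [hC (Y n ω) (X n ω), le_abs_self C]
      · rw [indicator_of_notMem hω, add_zero]
        have h1 : d n ω < ENNReal.ofReal r := by
          by_contra hne
          exact hω (subset_toMeasurable _ _ (not_lt.1 hne))
        have h2 : edist (f (Y n ω)) (f (X n ω)) ≤ L * ENNReal.ofReal r := by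
          refine (hL _ _).trans (mul_le_mul_right ?_ _)
          rw [edist_comm]
          exact (hXY n ω).trans h1.le
        rw [edist_dist, ← ENNReal.ofReal_coe_nnreal, ← ENNReal.ofReal_mul L.coe_nonneg] at h2
        exact (ENNReal.ofReal_le_ofReal_iff hLr).1 h2
    · rw [integral_add (integrable_const _) ((integrable_const _).indicator hAm),
        integral_indicator_const _ hAm, integral_const, probReal_univ, one_smul, smul_eq_mul,
        measureReal_def, hA, measure_toMeasurable, mul_comm |C|]
      rfl
  have hdist : Tendsto (fun n => dist (∫ ω, f (Y n ω) ∂P n) (∫ ω, f (X n ω) ∂P n)) atTop (𝓝 0) := by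
    refine tendsto_order.2 ⟨fun s hs => Filter.Eventually.of_forall fun n =>
      hs.trans_le dist_nonneg, fun s hs => ?_⟩
    obtain ⟨r, hr, hrs⟩ : ∃ r : ℝ, 0 < r ∧ L * r < s :=
      -- Adding `1` to `L` keeps the denominator positive when the Lipschitz constant is zero.
      ⟨s / (2 * (L + 1)), by positivity, by
        rw [mul_div_assoc', div_lt_iff₀ (by positivity)]
        nlinarith [L.coe_nonneg]⟩
    have h1 : Tendsto (fun n => L * r + |C| * (P n).real {ω | ENNReal.ofReal r ≤ d n ω}) atTop
        (𝓝 (L * r + |C| * 0)) := by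
      refine tendsto_const_nhds.add (tendsto_const_nhds.mul ?_)
      have := (ENNReal.tendsto_toReal ENNReal.zero_ne_top).comp
        (hd (ENNReal.ofReal r) (ENNReal.ofReal_pos.2 hr))
      simpa [Function.comp_def, measureReal_def] using this
    rw [mul_zero, add_zero] at h1
    exact ((tendsto_order.1 h1).2 s hrs).mono fun n hn => (hbound r hr n).trans_lt hn
  have e1 : ∀ n, ∫ x, f x ∂((P n).map (X n)) = ∫ ω, f (X n ω) ∂P n :=
    fun n => integral_map (hXm n) (hfm _)
  have e2 : ∀ n, ∫ x, f x ∂((P n).map (Y n)) = ∫ ω, f (Y n ω) ∂P n :=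
    fun n => integral_map (hY n) (hfm _)
  simp only [ProbabilityMeasure.coe_mk, e1] at hlim
  simp only [ProbabilityMeasure.coe_mk, e2]
  exact tendsto_of_tendsto_of_dist hlim (by simpa only [dist_comm] using hdist)

/-! ### Strata of spaces with a given number of points -/

namespace CompactRMSpace

/-- The spaces with at least `N` points. -/
def atLeast (N : ℕ) : Set CompactRMSpace :=
  {X | ∃ s : Fin N → X.carrier, Function.Injective s}

/-- Within less than half the minimal distance of `N` given points, a nearby space has a point close
to each, and no two of these can coincide. -/
theorem isOpen_atLeast (N : ℕ) : IsOpen (atLeast N) := by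
  rintro X ⟨s, hs⟩
  have hsep : ∀ᶠ δ in 𝓝[>] (0 : ℝ), ∀ i j, i ≠ j → 2 * δ < dist (s i) (s j) := by
    refine Filter.eventually_all.2 fun i => Filter.eventually_all.2 fun j => ?_
    by_cases hij : i = j
    · exact Filter.Eventually.of_forall fun δ h => absurd hij h
    · have h : Tendsto (fun δ : ℝ => 2 * δ) (𝓝[>] 0) (𝓝 (2 * 0)) :=
        (tendsto_const_nhds.mul tendsto_id).mono_left nhdsWithin_le_nhds
      rw [mul_zero] at h
      exact ((tendsto_order.1 h).2 _ (dist_pos.2 (hs.ne hij))).mono fun δ h _ => h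
  obtain ⟨δ, hδ, hδ0⟩ := (hsep.and self_mem_nhdsWithin).exists
  refine ⟨ENNReal.ofReal δ, ENNReal.ofReal_pos.2 hδ0, fun Y hY => ?_⟩
  obtain ⟨M, _, _, _, _, f, g, hf, hg, -, h2, -⟩ := exists_embedding_of_dGHP_lt hY
  have hex : ∀ i, ∃ y, dist (f (s i)) (g y) < δ := by
    intro i
    obtain ⟨z, ⟨y, rfl⟩, hy⟩ :=
      Metric.exists_edist_lt_of_hausdorffEDist_lt (mem_range_self (s i)) h2
    exact ⟨y, edist_lt_ofReal.1 hy⟩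
  choose t ht using hex
  refine ⟨t, fun i j hij => ?_⟩
  by_contra hne
  have h3 := hδ i j hne
  rw [← hf.dist_eq] at h3
  have h4 := dist_triangle_right (f (s i)) (f (s j)) (g (t i))
  have h5 := ht j
  rw [← hij] at h5
  linarith [ht i]

theorem mem_atLeast_iff {X : CompactRMSpace} [Finite X.carrier] {N : ℕ} :
    X ∈ atLeast N ↔ N ≤ Nat.card X.carrier := by
  constructor
  · rintro ⟨s, hs⟩
    simpa using Nat.card_le_card_of_injective s hs
  · intro h
    exact ⟨fun i => (Finite.equivFin X.carrier).symm (Fin.castLE h i),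
      (Equiv.injective _).comp (Fin.castLE_injective h)⟩

/-- The spaces with exactly `N` points. -/
def stratum (N : ℕ) : Set CompactRMSpace := atLeast N \ atLeast (N + 1)

theorem measurableSet_stratum (N : ℕ) : MeasurableSet (stratum N) :=
  (isOpen_atLeast N).measurableSet.diff (isOpen_atLeast (N + 1)).measurableSet

theorem mem_stratum_iff {X : CompactRMSpace} [Finite X.carrier] {N : ℕ} :
    X ∈ stratum N ↔ Nat.card X.carrier = N := by
  rw [stratum, Set.mem_sdiff, mem_atLeast_iff, mem_atLeast_iff]
  omega

end CompactRMSpace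

/-! ### Measurability of the traced space, and the theorem -/

/-- The restricted space carries the resistance metric of the trace, and the metric controls the
masses. So the traced space depends continuously on the restricted one as long as the number of
points is fixed. -/
theorem aemeasurable_scaledTrace {Ω : Type*} [MeasurableSpace Ω] {P : Measure Ω}
    {G : Ω → RootedNetwork} {a b : ℝ} (ha : 0 < a) (hb : 0 < b) {K : (ω : Ω) → Set (G ω).V}
    (hK : ∀ ω, IsCompact (X := ((G ω).scaled a b ha).carrier) (K ω))
    (hρ : ∀ ω, (G ω).root ∈ K ω)
    (hX : AEMeasurable (fun ω => ((G ω).scaled a b ha).restrict (K ω) (hK ω) (hρ ω)) P) :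
    AEMeasurable (fun ω => (G ω).scaledTrace a b ha (K ω) (hK ω) (hρ ω)) P := by
  have hfin : ∀ ω, Finite (K ω) := fun ω =>
    (ElectricalNetwork.finite_of_isCompact ha (hK ω)).to_subtype
  have : ∀ ω, Finite (((G ω).scaled a b ha).restrict (K ω) (hK ω) (hρ ω)).carrier := hfin
  refine aemeasurable_of_continuous_on_strata hX CompactRMSpace.measurableSet_stratum
    (fun ω => ⟨_, CompactRMSpace.mem_stratum_iff.2 rfl⟩) fun N ω hω U hU => ?_
  obtain ⟨ε, hε, hεU⟩ := EMetric.mem_nhds_iff.1 hU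
  have : Finite ((G ω).trace (K ω) (hρ ω)).V := hfin ω
  obtain ⟨δ, hδ, h⟩ := RootedNetwork.exists_forall_dGHP_finiteScaled_lt
    ((G ω).trace (K ω) (hρ ω)) ha hb hε
  refine ⟨_, Metric.eball_mem_nhds _ hδ, fun ω' hω' hωδ => hεU ?_⟩
  have h1 := h ((G ω').trace (K ω') (hρ ω')) (hfin ω') _ _
    (RootedNetwork.restrictIsometryTrace (G ω) a b ha (K ω) (hK ω) (hρ ω))
    (RootedNetwork.restrictIsometryTrace (G ω') a b ha (K ω') (hK ω') (hρ ω')) rfl rfl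
    ((CompactRMSpace.mem_stratum_iff.1 hω').trans (CompactRMSpace.mem_stratum_iff.1 hω).symm)
    (by rw [dGHP_comm]; exact hωδ)
  rw [dGHP_comm] at h1
  exact h1


theorem theoremA :
    -- deterministic networks
    (∀ (G : ℕ → RootedNetwork) (a b : ℕ → ℝ) (ha : ∀ n, 0 < a n) (_ : ∀ n, 0 < b n)
      (_ : ∀ n, (G n).IsRecurrent)
      (K : (n : ℕ) → Set (G n).V)
      (hK : ∀ n, IsCompact (X := ((G n).scaled (a n) (b n) (ha n)).carrier) (K n))
      (hρ : ∀ n, (G n).root ∈ K n)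
      (F : RMSpace) (_ : F.BoundedlyCompact)
      (L : Set F.carrier) (hL : IsCompact L) (hLρ : F.root ∈ L),
      Tendsto
        (fun n => dGHP (((G n).scaled (a n) (b n) (ha n)).restrict (K n) (hK n) (hρ n))
          (F.restrict L hL hLρ)) atTop (𝓝 0) →
      Tendsto (fun n => (G n).crossing (b n) (K n)) atTop (𝓝 0) →
      Tendsto
        (fun n => dGHP ((G n).scaledTrace (a n) (b n) (ha n) (K n) (hK n) (hρ n))
          (F.restrict L hL hLρ)) atTop (𝓝 0)) ∧
    -- random networks
    (∀ {Ω : ℕ → Type*} [∀ n, MeasurableSpace (Ω n)] (P : (n : ℕ) → Measure (Ω n))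
      [∀ n, IsProbabilityMeasure (P n)]
      {Ω' : Type*} [MeasurableSpace Ω'] (P' : Measure Ω') [IsProbabilityMeasure P']
      (G : (n : ℕ) → Ω n → RootedNetwork) (a b : ℕ → ℝ) (ha : ∀ n, 0 < a n) (_ : ∀ n, 0 < b n)
      (_ : ∀ n ω, (G n ω).IsRecurrent)
      (K : (n : ℕ) → (ω : Ω n) → Set (G n ω).V)
      (hK : ∀ n ω, IsCompact (X := ((G n ω).scaled (a n) (b n) (ha n)).carrier) (K n ω))
      (hρ : ∀ n ω, (G n ω).root ∈ K n ω)
      (F : Ω' → RMSpace) (_ : ∀ ω, (F ω).BoundedlyCompact)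
      (L : (ω : Ω') → Set (F ω).carrier) (hL : ∀ ω, IsCompact (L ω))
      (hLρ : ∀ ω, (F ω).root ∈ L ω),
      TendstoInDistribution
        (fun n ω => ((G n ω).scaled (a n) (b n) (ha n)).restrict (K n ω) (hK n ω) (hρ n ω))
        atTop (fun ω => (F ω).restrict (L ω) (hL ω) (hLρ ω)) P P' →
      (∀ ε : ℝ≥0∞, 0 < ε →
        Tendsto (fun n => P n {ω | ε ≤ (G n ω).crossing (b n) (K n ω)}) atTop (𝓝 0)) →
      TendstoInDistribution
        (fun n ω => (G n ω).scaledTrace (a n) (b n) (ha n) (K n ω) (hK n ω) (hρ n ω))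
        atTop (fun ω => (F ω).restrict (L ω) (hL ω) (hLρ ω)) P P') := by

  refine ⟨?_, ?_⟩
  · intro G a b ha hb _ K hK hρ F _ L hL hLρ hX hc
    -- The triangle inequality goes through the restricted space: crossing conductance plus the
    -- distance assumed to vanish.
    have h := hc.add hX
    rw [add_zero] at h
    refine tendsto_of_tendsto_of_tendsto_of_le_of_le tendsto_const_nhds h (fun _ => bot_le)
      fun n => (dGHP_triangle _ _ _).trans (add_le_add_left ?_ _)
    rw [dGHP_comm]
    exact RootedNetwork.dGHP_restrict_scaledTrace_le (G n) (ha n) (hb n) (K n) (hK n) (hρ n)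
  · intro Ω _ P _ Ω' _ P' _ G a b ha hb _ K hK hρ F _ L hL hLρ hX hc
    exact hX.of_edist_le
      (fun n => aemeasurable_scaledTrace (ha n) (hb n) (hK n) (hρ n) (hX.forall_aemeasurable n))
      (fun n ω => RootedNetwork.dGHP_restrict_scaledTrace_le (G n ω) (ha n) (hb n) (K n ω)
        (hK n ω) (hρ n ω)) hc
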